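/- **Theorem.** Consider a communication queue followed in tandem by a computation queue, both single-server and first-come first-served. Tasks $0,1,2,\dots$ arrive at times $\tau_0=0$, $\tau_k=\sum_{j=1}^k X_j$; task $k$ has transmission time $S_{k,t}$ and computation time $S_{k,c}$, its computation is completed at time $\tau_k'$, and its delay is $T_k=\tau_k'-\tau_k$. All times are nonnegative; the triples $(X_k,S_{k,t},S_{k,c})_{k\ge 0}$ (with $X_0$ the time between task $0$ and its predecessor) are i.i.d. with finite means; the network is stable, $\mathbb E[S_{k,t}]<\mathbb E[X_k]$ and $\mathbb E[S_{k,c}]<\mathbb E[X_k]$, and stationary: the joint law of the sequence of inter-arrival times, service times, delays in the communication queue and total delays is invariant under renumbering the tasks from the next one on. Let $w>0$ be a hard deadline: task $k$ is valid if and only if $T_k\le w$; assume $\Pr(T_0\le w)>0$. Let $N(t)$ be the largest index $k$ of a valid task with $\tau_k'\le t$ ($N(t)=0$ if there is none), let $c_{\rm hard}(t)=t-\tau_{N(t)}$ be the age of computing, and let $\Theta_{\rm hard}=\lim_{T\to\infty}\frac1T\int_0^T c_{\rm hard}(t)\,dt$. Let $M=\min\{n\ge 1: T_n\le w\}$, and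 let $\mathbb E$ in the next formula be the expectation given that task $0$ is valid, i.e. conditional on $T_0\le w$, so that $M$ is the number of tasks after a valid task up to and including the next valid task. Then, given $T_0\le w$, $M$ is almost surely finite; $\mathbb E[\sum_{j=1}^M X_j]\in(0,\infty)$ and $\mathbb E[T_M\sum_{j=1}^M X_j]<\infty$; and, almost surely under the unconditional law, $c_{\rm hard}$ is integrable on every interval $[0,t]$, the limit $\Theta_{\rm hard}$ exists in $[0,\infty]$, and $$\Theta_{\rm hard}=\frac{\mathbb E\big[T_M\sum_{j=1}^M X_j\big]+\frac12\,\mathbb E\big[\big(\sum_{j=1}^M X_j\big)^2\big]}{\mathbb E\big[\sum_{j=1}^M X_j\big]},$$ where both sides are $+\infty$ if $\mathbb E\big[\big(\sum_{j=1}^M X_j\big)^2\big]=\infty$. -/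

import Mathlib

open MeasureTheory ProbabilityTheory Filter Topology

/-- The random primitives of a communication queue followed in tandem by a computation queue.
Tasks are numbered `0, 1, 2, …` in the order of their arrival at the source, and task `0` arrives at
time `0`.  The number `X k` is the inter-arrival time between tasks `k - 1` and `k` (so `X 0` is the
time between task `0` and its predecessor), `St k` is the transmission time and `Sc k` the
computation time of task `k`; `waitT` and `waitC` are the times that task `0` waits in the
communication queue and in the computation queue because of the work left by earlier tasks. -/
structure TandemNetwork (Ω : Type*) where
  X : ℕ → Ω → ℝ
  St : ℕ → Ω → ℝ
  Sc : ℕ → Ω → ℝ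
  waitT : Ω → ℝ
  waitC : Ω → ℝ

namespace TandemNetwork

/-- The arrival time of task `k` at the source. -/
noncomputable def arrival {Ω : Type*} (net : TandemNetwork Ω) (k : ℕ) (ω : Ω) : ℝ :=
  ∑ j ∈ Finset.Icc 1 k, net.X j ω

/-- The time at which the transmission of task `k` ends (first come, first served: it begins when
the task has arrived and the transmission of its predecessor has ended). -/
noncomputable def received {Ω : Type*} (net : TandemNetwork Ω) : ℕ → Ω → ℝ
  | 0, ω => net.waitT ω + net.St 0 ω
  | k + 1, ω => max (net.arrival (k + 1) ω) (net.received k ω) + net.St (k + 1) ω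

/-- The time at which the computation of task `k` starts (first come, first served: when the task
has been received and the computation of its predecessor is complete). -/
noncomputable def start {Ω : Type*} (net : TandemNetwork Ω) : ℕ → Ω → ℝ
  | 0, ω => net.received 0 ω + net.waitC ω
  | k + 1, ω => max (net.received (k + 1) ω) (net.start k ω + net.Sc k ω)

/-- The time at which the computation of task `k` completes. -/
noncomputable def finish {Ω : Type*} (net : TandemNetwork Ω) (k : ℕ) (ω : Ω) : ℝ :=
  net.start k ω + net.Sc k ω

/-- The delay (system time) of task `k`. -/
noncomputable def delay {Ω : Type*} (net : TandemNetwork Ω) (k : ℕ) (ω : Ω) : ℝ :=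
  net.finish k ω - net.arrival k ω

/-- The part of the delay of task `k` that is spent in the communication queue. -/
noncomputable def commDelay {Ω : Type*} (net : TandemNetwork Ω) (k : ℕ) (ω : Ω) : ℝ :=
  net.received k ω - net.arrival k ω

/-- Under the hard deadline `w`, task `k` is valid if its delay does not exceed `w`. -/
def Valid {Ω : Type*} (net : TandemNetwork Ω) (w : ℝ) (k : ℕ) (ω : Ω) : Prop :=
  net.delay k ω ≤ w

/-- The index of the informative task during `[0, t]`: the last valid task that has been completed
by time `t`.  It is `0` as long as there is none. -/
noncomputable def informative {Ω : Type*} (net : TandemNetwork Ω) (w t : ℝ) (ω : Ω) : ℕ :=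
  sSup {k : ℕ | net.finish k ω ≤ t ∧ net.Valid w k ω}

/-- The age of computing at time `t` under the hard deadline `w`. (It equals `t` as long as no valid
task has been completed.) -/
noncomputable def aocHard {Ω : Type*} (net : TandemNetwork Ω) (w t : ℝ) (ω : Ω) : ℝ :=
  t - net.arrival (net.informative w t ω) ω

/-- The number `M` of tasks after task `0` up to and including the next valid task. -/
noncomputable def nextValid {Ω : Type*} (net : TandemNetwork Ω) (w : ℝ) (ω : Ω) : ℕ :=
  sInf {n : ℕ | 1 ≤ n ∧ net.Valid w n ω}

/-- `∑_{j = 1}^{M} X_j`: the time between the arrival of task `0` and that of the next valid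
task. -/
noncomputable def cycle {Ω : Type*} (net : TandemNetwork Ω) (w : ℝ) (ω : Ω) : ℝ :=
  ∑ j ∈ Finset.Icc 1 (net.nextValid w ω), net.X j ω

/-- `T_M`: the delay of the next valid task after task `0`. -/
noncomputable def nextDelay {Ω : Type*} (net : TandemNetwork Ω) (w : ℝ) (ω : Ω) : ℝ :=
  net.delay (net.nextValid w ω) ω

/-- The standing assumptions: the times are nonnegative random variables, the inter-arrival and
service times are i.i.d. over the tasks and have finite means, and the network is stationary, that
is, the joint law of all inter-arrival times, service times and delays does not change when the
tasks are renumbered from the next one on. -/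
structure IsStationary {Ω : Type*} [MeasurableSpace Ω] (net : TandemNetwork Ω)
    (μ : Measure Ω) : Prop where
  measurable_X : ∀ k, Measurable (net.X k)
  measurable_St : ∀ k, Measurable (net.St k)
  measurable_Sc : ∀ k, Measurable (net.Sc k)
  measurable_waitT : Measurable net.waitT
  measurable_waitC : Measurable net.waitC
  X_nonneg : ∀ k ω, 0 ≤ net.X k ω
  St_nonneg : ∀ k ω, 0 ≤ net.St k ω
  Sc_nonneg : ∀ k ω, 0 ≤ net.Sc k ω
  waitT_nonneg : ∀ ω, 0 ≤ net.waitT ω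
  waitC_nonneg : ∀ ω, 0 ≤ net.waitC ω
  integrable_X : Integrable (net.X 0) μ
  integrable_St : Integrable (net.St 0) μ
  integrable_Sc : Integrable (net.Sc 0) μ
  indep : iIndepFun (fun k ω => (net.X k ω, net.St k ω, net.Sc k ω)) μ
  ident : ∀ k, IdentDistrib (fun ω => (net.X k ω, net.St k ω, net.Sc k ω))
    (fun ω => (net.X 0 ω, net.St 0 ω, net.Sc 0 ω)) μ μ
  stationary :
    μ.map (fun ω (k : ℕ) => (net.X (k + 1) ω, net.St (k + 1) ω, net.Sc (k + 1) ω,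
      net.commDelay (k + 1) ω, net.delay (k + 1) ω)) =
    μ.map (fun ω (k : ℕ) => (net.X k ω, net.St k ω, net.Sc k ω,
      net.commDelay k ω, net.delay k ω))

end TandemNetwork

/-! Between the completions of consecutive valid tasks the age grows with slope one, from the delay
of the first to the delay `T'` of the second plus the time `C` between their arrivals. The area is
therefore `T' C + C² / 2`, up to half a difference of squared delays, which telescopes. Valid delays
lie in `[0, w]`, so the boundary terms are negligible, and the time average is the reward per task
divided by the mean inter-arrival time.

Successive cycles are neither independent nor identically distributed under the unconditional law,
so renewal theory does not apply. Instead the sequence of inter-arrival times and delays is shown to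
be ergodic under the shift (`ergodic_seqShift`): stability makes the network forget its initial
delays (`exists_tandemState_eq_zero_start`), so a shift-invariant event almost surely agrees with a
tail event of the independent inputs, and Kolmogorov's zero-one law applies.

The pointwise ergodic theorem, applied to functions supported on `validSeq` and evaluated at the
indices of valid tasks, then gives averages over cycles. For `seqCycle` this is Kac's formula, which
identifies the denominator; for `seqReward` it gives the numerator. An infinite second moment makes
the reward averages diverge. Sublinear gaps between valid tasks and monotonicity of the integral
extend the limit to all times. -/

/-! ### The pointwise ergodic theorem, by the maximal function. -/

section PointwiseErgodic

/-- The running maximum `max (0, S₁, …, Sₙ)` of the Birkhoff sums of `h` along `T`. -/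
noncomputable def birkhoffMax {α : Type*} (T : α → α) (h : α → ℝ) : ℕ → α → ℝ
  | 0, _ => 0
  | n + 1, x => max 0 (h x + birkhoffMax T h n (T x))

variable {α : Type*} {T : α → α} {h : α → ℝ}

lemma birkhoffMax_nonneg (n : ℕ) (x : α) : 0 ≤ birkhoffMax T h n x := by
  cases n <;> simp [birkhoffMax]

lemma birkhoffMax_le_succ (n : ℕ) (x : α) : birkhoffMax T h n x ≤ birkhoffMax T h (n + 1) x := by
  induction n generalizing x with
  | zero => simp [birkhoffMax]
  | succ n ih =>
    rw [birkhoffMax, birkhoffMax]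
    exact max_le_max le_rfl (add_le_add le_rfl (ih _))

lemma birkhoffMax_monotone (x : α) : Monotone fun n => birkhoffMax T h n x :=
  monotone_nat_of_le_succ fun n => birkhoffMax_le_succ n x

lemma birkhoffSum_le_birkhoffMax (n : ℕ) (x : α) : birkhoffSum T h n x ≤ birkhoffMax T h n x := by
  induction n generalizing x with
  | zero => simp [birkhoffMax]
  | succ n ih =>
    rw [birkhoffSum_succ', birkhoffMax]
    exact le_max_of_le_right (add_le_add le_rfl (ih _))

/-- This makes the set of points with bounded maxima exactly invariant, so that ergodicity gives it
measure zero or one. -/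
lemma bddAbove_birkhoffMax_comp_iff (x : α) :
    BddAbove (Set.range fun n => birkhoffMax T h n (T x)) ↔
      BddAbove (Set.range fun n => birkhoffMax T h n x) := by
  constructor
  · rintro ⟨B, hB⟩
    refine ⟨max 0 (h x + B), ?_⟩
    rintro _ ⟨n, rfl⟩
    refine (birkhoffMax_le_succ n x).trans ?_
    exact max_le_max le_rfl (add_le_add le_rfl (hB ⟨n, rfl⟩))
  · rintro ⟨B, hB⟩
    refine ⟨B - h x, ?_⟩
    rintro _ ⟨n, rfl⟩
    have h1 : birkhoffMax T h (n + 1) x ≤ B := hB ⟨n + 1, rfl⟩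
    have h2 : h x + birkhoffMax T h n (T x) ≤ birkhoffMax T h (n + 1) x := le_max_right _ _
    simp only
    linarith

variable [MeasurableSpace α] {ν : Measure α}

lemma measurable_birkhoffMax (hT : Measurable T) (hh : Measurable h) (n : ℕ) :
    Measurable (birkhoffMax T h n) := by
  induction n with
  | zero => exact measurable_const
  | succ n ih => exact measurable_const.max (hh.add (ih.comp hT))

lemma integrable_birkhoffMax (hT : MeasurePreserving T ν ν) (hi : Integrable h ν) (n : ℕ) :
    Integrable (birkhoffMax T h n) ν := by
  induction n with
  | zero => exact integrable_zero _ _ _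
  | succ n ih =>
    exact (integrable_zero _ _ _).sup (hi.add (hT.integrable_comp_of_integrable ih))

/-- A function of negative mean has Birkhoff sums that are almost surely bounded above. -/
lemma Ergodic.ae_bddAbove_birkhoffMax [IsProbabilityMeasure ν] (hT : Ergodic T ν)
    (hh : Measurable h) (hi : Integrable h ν) (hneg : ∫ x, h x ∂ν < 0) :
    ∀ᵐ x ∂ν, BddAbove (Set.range fun n => birkhoffMax T h n x) := by
  have hmp := hT.toMeasurePreserving
  set A : Set α := {x | BddAbove (Set.range fun n => birkhoffMax T h n x)} with hA
  have hAm : MeasurableSet A :=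
    measurableSet_bddAbove_range fun n => measurable_birkhoffMax hmp.measurable hh n
  have hinv : T ⁻¹' A = A := by
    ext x
    exact bddAbove_birkhoffMax_comp_iff x
  rcases hT.toPreErgodic.ae_mem_or_ae_notMem hAm hinv with h1 | h1
  · exact h1
  · exfalso
    -- The integrand is the maximum at `n + 1` minus the maximum at `n` composed with `T`;
    -- invariance of `ν` removes `T`, and the maxima increase in `n`.
    have hnn : ∀ n, 0 ≤ ∫ x, max (-birkhoffMax T h n (T x)) (h x) ∂ν := by
      intro n
      have e : ∀ x, max (-birkhoffMax T h n (T x)) (h x)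
          = birkhoffMax T h (n + 1) x - birkhoffMax T h n (T x) := by
        intro x
        rw [birkhoffMax, ← max_sub_sub_right]
        congr 1 <;> ring
      simp_rw [e]
      have i1 := integrable_birkhoffMax hmp hi n
      have i2 := integrable_birkhoffMax hmp hi (n + 1)
      have i3 : Integrable (fun x => birkhoffMax T h n (T x)) ν :=
        hmp.integrable_comp_of_integrable i1
      rw [integral_sub i2 i3]
      have e2 : ∫ x, birkhoffMax T h n (T x) ∂ν = ∫ x, birkhoffMax T h n x ∂ν := by
        conv_rhs => rw [← hmp.map_eq]
        rw [integral_map hmp.measurable.aemeasurable]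
        exact (measurable_birkhoffMax hmp.measurable hh n).aestronglyMeasurable
      rw [e2, ← integral_sub i2 i1]
      exact integral_nonneg fun x => sub_nonneg.2 (birkhoffMax_le_succ n x)
    -- Where the maxima diverge, the integrand eventually equals `h`. Hence `h` would have
    -- nonnegative mean.
    have hlim : Tendsto (fun n => ∫ x, max (-birkhoffMax T h n (T x)) (h x) ∂ν) atTop
        (𝓝 (∫ x, h x ∂ν)) := by
      refine tendsto_integral_of_dominated_convergence (fun x => |h x|) ?_ hi.abs ?_ ?_
      · intro n
        exact (((measurable_birkhoffMax hmp.measurable hh n).comp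
          hmp.measurable).neg.max hh).aestronglyMeasurable
      · intro n
        refine Eventually.of_forall fun x => ?_
        have := birkhoffMax_nonneg (T := T) (h := h) n (T x)
        rw [Real.norm_eq_abs, abs_le]
        constructor
        · exact (neg_abs_le _).trans (le_max_right _ _)
        · exact max_le (by linarith [abs_nonneg (h x)]) (le_abs_self _)
      · filter_upwards [h1] with x hx
        have hx' : ¬ BddAbove (Set.range fun n => birkhoffMax T h n (T x)) := by
          rw [bddAbove_birkhoffMax_comp_iff]
          exact hx
        have ht : Tendsto (fun n => birkhoffMax T h n (T x)) atTop atTop := by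
          refine tendsto_atTop_atTop_of_monotone (birkhoffMax_monotone _) fun b => ?_
          by_contra! hb
          exact hx' ⟨b, by rintro _ ⟨n, rfl⟩; exact (hb n).le⟩
        refine tendsto_const_nhds.congr' ?_
        filter_upwards [ht.eventually_ge_atTop (-h x)] with n hn
        rw [max_eq_right]
        linarith
    have := ge_of_tendsto' hlim hnn
    linarith

/-- For `d` between the mean and `c`, the sums of `h - d` are bounded above by some `B`, so the
averages of `h` are at most `d + B / n`. -/
lemma Ergodic.ae_eventually_birkhoffSum_div_lt [IsProbabilityMeasure ν] (hT : Ergodic T ν)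
    (hh : Measurable h) (hi : Integrable h ν) {c : ℝ} (hc : ∫ x, h x ∂ν < c) :
    ∀ᵐ x ∂ν, ∀ᶠ n : ℕ in atTop, birkhoffSum T h n x / n < c := by
  obtain ⟨d, hd1, hd2⟩ := exists_between hc
  have hneg : ∫ x, (h x - d) ∂ν < 0 := by
    rw [integral_sub hi (integrable_const _)]
    simpa using hd1
  filter_upwards [hT.ae_bddAbove_birkhoffMax (h := fun x => h x - d) (hh.sub_const d)
    (hi.sub (integrable_const _)) hneg] with x ⟨B, hB⟩
  have hlim : Tendsto (fun n : ℕ => B / (n : ℝ)) atTop (𝓝 0) :=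
    tendsto_const_div_atTop_nhds_zero_nat B
  filter_upwards [hlim.eventually_lt_const (sub_pos.2 hd2), eventually_gt_atTop 0] with n hn hn0
  have h1 : birkhoffSum T (fun x => h x - d) n x ≤ B :=
    (birkhoffSum_le_birkhoffMax n x).trans (hB ⟨n, rfl⟩)
  have h2 : birkhoffSum T (fun x => h x - d) n x = birkhoffSum T h n x - n * d := by
    simp [birkhoffSum, Finset.sum_sub_distrib]
  have hn' : (0 : ℝ) < n := by exact_mod_cast hn0
  rw [div_lt_iff₀ hn'] at hn ⊢
  nlinarith

/-- **Pointwise ergodic theorem** for an ergodic transformation. -/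
theorem Ergodic.ae_tendsto_birkhoffSum_div [IsProbabilityMeasure ν] (hT : Ergodic T ν)
    (hh : Measurable h) (hi : Integrable h ν) :
    ∀ᵐ x ∂ν, Tendsto (fun n : ℕ => birkhoffSum T h n x / n) atTop (𝓝 (∫ x, h x ∂ν)) := by
  have key : ∀ g : α → ℝ, Measurable g → Integrable g ν → ∀ᵐ x ∂ν, ∀ k : ℕ,
      ∀ᶠ n : ℕ in atTop, birkhoffSum T g n x / n < ∫ x, g x ∂ν + 1 / ((k : ℝ) + 1) := by
    intro g hg hgi
    rw [ae_all_iff]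
    intro k
    refine hT.ae_eventually_birkhoffSum_div_lt hg hgi ?_
    have : (0 : ℝ) < 1 / ((k : ℝ) + 1) := by positivity
    linarith
  filter_upwards [key h hh hi, key (fun x => -h x) hh.neg hi.neg] with x h1 h2
  rw [tendsto_order]
  constructor
  · intro c hc
    obtain ⟨k, hk⟩ := exists_nat_one_div_lt (sub_pos.2 hc)
    filter_upwards [h2 k] with n hn
    have e : birkhoffSum T (fun x => -h x) n x = - birkhoffSum T h n x := by
      simp [birkhoffSum]
    rw [e, neg_div, integral_neg] at hn
    linarith
  · intro c hc
    obtain ⟨k, hk⟩ := exists_nat_one_div_lt (sub_pos.2 hc)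
    filter_upwards [h1 k] with n hn
    linarith

/-- The averages of a nonnegative function of infinite mean diverge. -/
theorem Ergodic.ae_tendsto_birkhoffSum_div_atTop [IsProbabilityMeasure ν] (hT : Ergodic T ν)
    (hh : Measurable h) (h0 : 0 ≤ᵐ[ν] h) (hi : ¬ Integrable h ν) :
    ∀ᵐ x ∂ν, Tendsto (fun n : ℕ => birkhoffSum T h n x / n) atTop atTop := by
  -- Along almost every orbit `h` agrees with its absolute value.
  wlog hpos : ∀ x, 0 ≤ h x generalizing h
  · have hi' : ¬ Integrable (fun x => |h x|) ν := fun hc => hi ((integrable_norm_iff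
      hh.aestronglyMeasurable).1 hc)
    have hall : ∀ᵐ x ∂ν, ∀ k, 0 ≤ h (T^[k] x) :=
      ae_all_iff.2 fun k => (hT.toMeasurePreserving.iterate k).quasiMeasurePreserving.ae h0
    filter_upwards [this hh.abs (Eventually.of_forall fun x => abs_nonneg _) hi'
      fun x => abs_nonneg _, hall] with x hx hx'
    refine hx.congr fun n => ?_
    simp only [birkhoffSum, abs_of_nonneg (hx' _)]
  have htm : ∀ K : ℕ, Measurable fun x => min (h x) K := fun K => hh.min measurable_const
  have hti : ∀ K : ℕ, Integrable (fun x => min (h x) K) ν := fun K => by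
    refine Integrable.of_bound (htm K).aestronglyMeasurable K (Eventually.of_forall fun x => ?_)
    rw [Real.norm_eq_abs, abs_of_nonneg (le_min (hpos x) (by positivity))]
    exact min_le_right _ _
  have hunb : ∀ C : ℝ, ∃ K : ℕ, C < ∫ x, min (h x) K ∂ν := by
    intro C
    by_contra! hC
    apply hi
    -- Bounded integrals of the truncations would make `h` integrable, by monotone convergence.
    refine ⟨hh.aestronglyMeasurable, ?_⟩
    rw [hasFiniteIntegral_iff_ofReal (Eventually.of_forall hpos)]
    have hmono : Tendsto (fun K : ℕ => ∫⁻ x, ENNReal.ofReal (min (h x) K) ∂ν) atTop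
        (𝓝 (∫⁻ x, ENNReal.ofReal (h x) ∂ν)) := by
      refine lintegral_tendsto_of_tendsto_of_monotone
        (fun K => (htm K).ennreal_ofReal.aemeasurable) ?_ ?_
      · refine Eventually.of_forall fun x K L hKL => ENNReal.ofReal_le_ofReal ?_
        exact min_le_min le_rfl (by exact_mod_cast hKL)
      · refine Eventually.of_forall fun x => tendsto_const_nhds.congr' ?_
        filter_upwards [eventually_ge_atTop ⌈h x⌉₊] with K hK
        rw [min_eq_left]
        exact (Nat.le_ceil _).trans (by exact_mod_cast hK)
    refine lt_of_le_of_lt (le_of_tendsto' hmono (b := ENNReal.ofReal C) fun K => ?_)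
      ENNReal.ofReal_lt_top
    rw [← ofReal_integral_eq_lintegral_ofReal (hti K)
      (Eventually.of_forall fun x => le_min (hpos x) (by positivity))]
    exact ENNReal.ofReal_le_ofReal (hC K)
  have hall : ∀ᵐ x ∂ν, ∀ K : ℕ, Tendsto (fun n : ℕ => birkhoffSum T (fun x => min (h x) K) n x / n)
      atTop (𝓝 (∫ x, min (h x) K ∂ν)) :=
    ae_all_iff.2 fun K => hT.ae_tendsto_birkhoffSum_div (htm K) (hti K)
  filter_upwards [hall] with x hx
  rw [tendsto_atTop]
  intro C
  obtain ⟨K, hK⟩ := hunb C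
  filter_upwards [(hx K).eventually_const_lt hK] with n hn
  refine hn.le.trans ?_
  gcongr
  exact Finset.sum_le_sum fun i _ => min_le_left _ _

end PointwiseErgodic

/-! ### The Lindley recursion and the loss of memory of its initial state. -/

section Lindley

/-- One step of the Lindley recursion of the tandem network: the delays `(D, T)` of a task in the
communication queue and in the network determine those of the next task, given the inter-arrival,
transmission and computation times `(x, s, c)` of the latter. -/
noncomputable def tandemStep (s : ℝ × ℝ) (u : ℝ × ℝ × ℝ) : ℝ × ℝ :=
  (max 0 (s.1 - u.1) + u.2.1, max (max 0 (s.1 - u.1) + u.2.1) (s.2 - u.1) + u.2.2)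

/-- The delays of the `n`-th task after one with delays `s`. -/
noncomputable def tandemState (u : ℕ → ℝ × ℝ × ℝ) (s : ℝ × ℝ) : ℕ → ℝ × ℝ
  | 0 => s
  | n + 1 => tandemStep (tandemState u s n) (u n)

lemma tandemStep_mono {s s' : ℝ × ℝ} (h : s ≤ s') (u : ℝ × ℝ × ℝ) :
    tandemStep s u ≤ tandemStep s' u := by
  obtain ⟨h1, h2⟩ := h
  constructor <;> simp only [tandemStep] <;> gcongr

lemma tandemState_mono {s s' : ℝ × ℝ} (h : s ≤ s') (u : ℕ → ℝ × ℝ × ℝ) (n : ℕ) :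
    tandemState u s n ≤ tandemState u s' n := by
  induction n with
  | zero => exact h
  | succ n ih => exact tandemStep_mono ih _

lemma tandemState_nonneg {u : ℕ → ℝ × ℝ × ℝ} (hu : ∀ n, 0 ≤ u n) {s : ℝ × ℝ} (hs : 0 ≤ s) (n : ℕ) :
    0 ≤ tandemState u s n := by
  induction n with
  | zero => exact hs
  | succ n ih =>
    obtain ⟨-, h2, h3⟩ := hu n
    have h4 : 0 ≤ max 0 ((tandemState u s n).1 - (u n).1) + (u n).2.1 :=
      add_nonneg (le_max_left _ _) h2
    exact ⟨h4, add_nonneg (le_max_of_le_left h4) h3⟩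

lemma tandemState_eq_of_ge {u : ℕ → ℝ × ℝ × ℝ} {s s' : ℝ × ℝ} {N : ℕ}
    (h : tandemState u s N = tandemState u s' N) : ∀ n ≥ N, tandemState u s n = tandemState u s' n := by
  intro n hn
  induction n, hn using Nat.le_induction with
  | base => exact h
  | succ n _ ih => rw [tandemState, tandemState, ih]

lemma tandemState_fst_eq_of_ge {u : ℕ → ℝ × ℝ × ℝ} {s s' : ℝ × ℝ} {N : ℕ}
    (h : (tandemState u s N).1 = (tandemState u s' N).1) :
    ∀ n ≥ N, (tandemState u s n).1 = (tandemState u s' n).1 := by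
  intro n hn
  induction n, hn using Nat.le_induction with
  | base => exact h
  | succ n _ ih => simp only [tandemState, tandemStep, ih]

/-- In a stable network the initial delays are eventually forgotten. -/
theorem exists_tandemState_eq_zero_start {u : ℕ → ℝ × ℝ × ℝ} (hu : ∀ n, 0 ≤ u n) {s : ℝ × ℝ}
    (hs : 0 ≤ s)
    (h1 : Tendsto (fun n => ∑ i ∈ Finset.range n, ((u i).1 - (u i).2.1)) atTop atTop)
    (h2 : Tendsto (fun n => ∑ i ∈ Finset.range n, ((u i).1 - (u i).2.2)) atTop atTop) :
    ∃ N, ∀ n ≥ N, tandemState u s n = tandemState u 0 n := by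
  have hle := tandemState_mono hs u
  -- Some task finds the communication queue empty: otherwise its delay would be `s.1` minus the
  -- accumulated drift and become negative. By monotonicity the queue started from `0` is empty then
  -- too, and the two merge.
  obtain ⟨N, hN⟩ : ∃ n, (tandemState u s n).1 ≤ (u n).1 := by
    by_contra! hc
    have e : ∀ n, (tandemState u s n).1 + ∑ i ∈ Finset.range n, ((u i).1 - (u i).2.1) = s.1 := by
      intro n
      induction n with
      | zero => simp [tandemState]
      | succ n ih =>
        rw [Finset.sum_range_succ, tandemState, tandemStep, max_eq_right (sub_nonneg.2 (hc n).le)]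
        linarith
    obtain ⟨n, hn⟩ := (h1.eventually_gt_atTop s.1).exists
    linarith [e n, (tandemState_nonneg hu hs n).1, show (0 : ℝ × ℝ).1 = 0 from rfl]
  have hfst : ∀ n ≥ N + 1, (tandemState u s n).1 = (tandemState u 0 n).1 := by
    refine tandemState_fst_eq_of_ge ?_
    simp only [tandemState, tandemStep]
    rw [max_eq_left (by linarith), max_eq_left (by linarith [(hle N).1])]
  -- The same argument for the computation server, once the communication delays agree: a server
  -- that never idles would push the total delay below zero.
  obtain ⟨M, hMN, hM⟩ : ∃ n ≥ N + 1, (tandemState u s n).2 - (u n).1 ≤ (tandemState u s (n + 1)).1 := by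
    by_contra! hc
    have e : ∀ n ≥ N + 1, (tandemState u s n).2 + ∑ i ∈ Finset.range n, ((u i).1 - (u i).2.2) =
        (tandemState u s (N + 1)).2 + ∑ i ∈ Finset.range (N + 1), ((u i).1 - (u i).2.2) := by
      intro n hn
      induction n, hn using Nat.le_induction with
      | base => rfl
      | succ n hn ih =>
        have := hc n hn
        rw [← ih, Finset.sum_range_succ]
        simp only [tandemState, tandemStep] at this ⊢
        rw [max_eq_right this.le]
        ring
    obtain ⟨n, hn, hn'⟩ := ((h2.eventually_gt_atTop ((tandemState u s (N + 1)).2 +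
      ∑ i ∈ Finset.range (N + 1), ((u i).1 - (u i).2.2))).and (eventually_ge_atTop (N + 1))).exists
    linarith [e n hn', (tandemState_nonneg hu hs n).2, show (0 : ℝ × ℝ).2 = 0 from rfl]
  refine ⟨M + 1, tandemState_eq_of_ge ?_⟩
  have hD := hfst (M + 1) (by omega)
  refine Prod.ext hD ?_
  have h3 := (hle M).2
  simp only [tandemState, tandemStep] at hD hM ⊢
  rw [hD] at hM ⊢
  rw [max_eq_left hM, max_eq_left ((sub_le_sub_right h3 _).trans hM)]

end Lindley

/-! ### The network as a recursion driven by independent inputs. -/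

namespace TandemNetwork

variable {Ω : Type*} (net : TandemNetwork Ω)

/-- The inter-arrival, transmission and computation times of a task. -/
def input (k : ℕ) (ω : Ω) : ℝ × ℝ × ℝ := (net.X k ω, net.St k ω, net.Sc k ω)

/-- The sequence of inter-arrival times and delays. -/
noncomputable def path (ω : Ω) (k : ℕ) : ℝ × ℝ := (net.X k ω, net.delay k ω)

/-- The inter-arrival times and delays from task `m + 1` on if task `m` had no delay. -/
noncomputable def freshPath (m : ℕ) (ω : Ω) (j : ℕ) : ℝ × ℝ :=
  (net.X (m + 1 + j) ω, (tandemState (fun n => net.input (m + 1 + n) ω) 0 (j + 1)).2)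

lemma arrival_succ (k : ℕ) (ω : Ω) : net.arrival (k + 1) ω = net.arrival k ω + net.X (k + 1) ω := by
  rw [arrival, arrival, Finset.sum_Icc_succ_top (by omega)]

@[simp] lemma arrival_zero (ω : Ω) : net.arrival 0 ω = 0 := by simp [arrival]

lemma delays_succ (k : ℕ) (ω : Ω) : (net.commDelay (k + 1) ω, net.delay (k + 1) ω) =
    tandemStep (net.commDelay k ω, net.delay k ω) (net.input (k + 1) ω) := by
  have h1 : net.commDelay (k + 1) ω =
      max 0 (net.commDelay k ω - net.X (k + 1) ω) + net.St (k + 1) ω := by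
    simp only [commDelay, received, arrival_succ]
    rw [sub_sub, ← sub_self (net.arrival k ω + net.X (k + 1) ω), max_sub_sub_right]
    ring
  have h2 : net.delay (k + 1) ω =
      max (net.commDelay (k + 1) ω) (net.delay k ω - net.X (k + 1) ω) + net.Sc (k + 1) ω := by
    simp only [delay, finish, start]
    rw [sub_sub, ← arrival_succ, commDelay, max_sub_sub_right]
    ring
  rw [Prod.ext_iff]
  exact ⟨h1, by rw [h2, h1]; rfl⟩

lemma delays_add (m n : ℕ) (ω : Ω) : (net.commDelay (m + n) ω, net.delay (m + n) ω) =
    tandemState (fun n => net.input (m + 1 + n) ω) (net.commDelay m ω, net.delay m ω) n := by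
  induction n with
  | zero => rfl
  | succ n ih =>
    rw [tandemState, ← ih, ← add_assoc, delays_succ]
    congr 2
    omega

/-- Unlike `path`, this sequence involves neither the initial waiting times nor the earlier inputs;
this is what yields tail events. -/
lemma measurable_freshPath (m : ℕ) :
    Measurable[⨆ i ≥ m, MeasurableSpace.comap (net.input i) inferInstance] (net.freshPath m) := by
  have hin : ∀ j, Measurable[⨆ i ≥ m, MeasurableSpace.comap (net.input i) inferInstance]
      (net.input (m + 1 + j)) := fun j =>
    (comap_measurable (net.input (m + 1 + j))).mono
      (le_iSup₂_of_le (m + 1 + j) (by omega) le_rfl) le_rfl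
  generalize (⨆ i ≥ m, MeasurableSpace.comap (net.input i) inferInstance) = ms at hin
  have hst : ∀ j, Measurable fun ω => tandemState (fun n => net.input (m + 1 + n) ω) 0 j := by
    intro j
    induction j with
    | zero => exact measurable_const
    | succ j ih =>
      have h3 : Measurable fun p : (ℝ × ℝ) × (ℝ × ℝ × ℝ) => tandemStep p.1 p.2 := by
        unfold tandemStep
        fun_prop
      exact h3.comp (ih.prodMk (hin j))
  exact measurable_pi_lambda _ fun j => (hin j).fst.prodMk (hst (j + 1)).snd

variable {net} [MeasurableSpace Ω] {μ : Measure Ω}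

namespace IsStationary

variable (hnet : net.IsStationary μ)
include hnet

lemma input_nonneg (k : ℕ) (ω : Ω) : 0 ≤ net.input k ω :=
  ⟨hnet.X_nonneg k ω, hnet.St_nonneg k ω, hnet.Sc_nonneg k ω⟩

lemma delays_nonneg (k : ℕ) (ω : Ω) : 0 ≤ (net.commDelay k ω, net.delay k ω) := by
  have h0 : 0 ≤ (net.commDelay 0 ω, net.delay 0 ω) := by
    constructor
    · simpa [commDelay, received] using add_nonneg (hnet.waitT_nonneg ω) (hnet.St_nonneg 0 ω)
    · simpa [delay, finish, start, received] using add_nonneg (add_nonneg (add_nonneg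
        (hnet.waitT_nonneg ω) (hnet.St_nonneg 0 ω)) (hnet.waitC_nonneg ω)) (hnet.Sc_nonneg 0 ω)
  have := net.delays_add 0 k ω
  rw [zero_add] at this
  rw [this]
  exact tandemState_nonneg (fun n => hnet.input_nonneg _ _) h0 k

lemma delay_nonneg (k : ℕ) (ω : Ω) : 0 ≤ net.delay k ω := (hnet.delays_nonneg k ω).2

lemma measurable_input (k : ℕ) : Measurable (net.input k) :=
  (hnet.measurable_X k).prodMk ((hnet.measurable_St k).prodMk (hnet.measurable_Sc k))

lemma measurable_arrival (k : ℕ) : Measurable (net.arrival k) :=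
  Finset.measurable_fun_sum _ fun j _ => hnet.measurable_X j

lemma measurable_received (k : ℕ) : Measurable (net.received k) := by
  induction k with
  | zero => exact hnet.measurable_waitT.add (hnet.measurable_St 0)
  | succ k ih => exact ((hnet.measurable_arrival _).max ih).add (hnet.measurable_St _)

lemma measurable_start (k : ℕ) : Measurable (net.start k) := by
  induction k with
  | zero => exact (hnet.measurable_received 0).add hnet.measurable_waitC
  | succ k ih => exact (hnet.measurable_received _).max (ih.add (hnet.measurable_Sc _))

lemma measurable_delay (k : ℕ) : Measurable (net.delay k) :=
  ((hnet.measurable_start k).add (hnet.measurable_Sc k)).sub (hnet.measurable_arrival k)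

lemma measurable_commDelay (k : ℕ) : Measurable (net.commDelay k) :=
  (hnet.measurable_received k).sub (hnet.measurable_arrival k)

lemma measurable_path : Measurable net.path :=
  measurable_pi_lambda _ fun k => (hnet.measurable_X k).prodMk (hnet.measurable_delay k)

/-- The strong law of large numbers for a function of the inputs of a task. -/
lemma ae_tendsto_sum_input_div {φ : ℝ × ℝ × ℝ → ℝ} (hφ : Measurable φ)
    (hi : Integrable (fun ω => φ (net.input 0 ω)) μ) :
    ∀ᵐ ω ∂μ, Tendsto (fun n : ℕ => (∑ i ∈ Finset.range n, φ (net.input i ω)) / n) atTop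
      (𝓝 (∫ ω, φ (net.input 0 ω) ∂μ)) :=
  strong_law_ae_real (fun k ω => φ (net.input k ω)) hi
    (fun _ _ hij => (hnet.indep.indepFun hij).comp hφ hφ) fun k => (hnet.ident k).comp hφ

lemma ae_tendsto_sum_input {φ : ℝ × ℝ × ℝ → ℝ} (hφ : Measurable φ)
    (hi : Integrable (fun ω => φ (net.input 0 ω)) μ) (hpos : 0 < ∫ ω, φ (net.input 0 ω) ∂μ) :
    ∀ᵐ ω ∂μ, ∀ m, Tendsto (fun n : ℕ => ∑ i ∈ Finset.range n, φ (net.input (m + i) ω)) atTop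
      atTop := by
  filter_upwards [hnet.ae_tendsto_sum_input_div hφ hi] with ω h m
  have h1 : Tendsto (fun n : ℕ => ∑ i ∈ Finset.range n, φ (net.input i ω)) atTop atTop := by
    refine (h.pos_mul_atTop hpos tendsto_natCast_atTop_atTop).congr' ?_
    filter_upwards [eventually_gt_atTop 0] with n hn
    field_simp
  have h2 := tendsto_atTop_add_const_right atTop (-∑ i ∈ Finset.range m, φ (net.input i ω))
    (h1.comp (tendsto_add_atTop_nat m))
  refine h2.congr fun n => ?_
  simp only [Function.comp]
  rw [add_comm n m, Finset.sum_range_add]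
  ring

/-- By the strong law, the two stability conditions give the two divergent drifts needed to forget
the delays of task `m`. -/
lemma ae_eventually_freshPath_eq (hSt : ∫ ω, net.St 0 ω ∂μ < ∫ ω, net.X 0 ω ∂μ)
    (hSc : ∫ ω, net.Sc 0 ω ∂μ < ∫ ω, net.X 0 ω ∂μ) :
    ∀ᵐ ω ∂μ, ∀ m, ∃ N, ∀ j ≥ N, net.freshPath m ω j = net.path ω (m + 1 + j) := by
  have h1 := hnet.ae_tendsto_sum_input (φ := fun u => u.1 - u.2.1) (by fun_prop)
    (hnet.integrable_X.sub hnet.integrable_St)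
    (by simpa [input, integral_sub hnet.integrable_X hnet.integrable_St] using hSt)
  have h2 := hnet.ae_tendsto_sum_input (φ := fun u => u.1 - u.2.2) (by fun_prop)
    (hnet.integrable_X.sub hnet.integrable_Sc)
    (by simpa [input, integral_sub hnet.integrable_X hnet.integrable_Sc] using hSc)
  filter_upwards [h1, h2] with ω h1 h2 m
  obtain ⟨N, hN⟩ := exists_tandemState_eq_zero_start
    (fun n => hnet.input_nonneg (m + 1 + n) ω) (hnet.delays_nonneg m ω) (h1 (m + 1)) (h2 (m + 1))
  refine ⟨N, fun j hj => ?_⟩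
  rw [freshPath, path, ← hN (j + 1) (by omega), ← delays_add, add_right_comm, add_assoc m]

end IsStationary

end TandemNetwork

/-! ### Ergodicity of the shift. -/

/-- The shift on sequences. -/
def seqShift {β : Type*} (x : ℕ → β) (k : ℕ) : β := x (k + 1)

lemma seqShift_iterate {β : Type*} (n : ℕ) (x : ℕ → β) (k : ℕ) :
    seqShift^[n] x k = x (k + n) := by
  induction n generalizing x with
  | zero => rfl
  | succ n ih =>
    rw [Function.iterate_succ_apply, ih, seqShift]
    congr 1

lemma measurable_seqShift {β : Type*} [MeasurableSpace β] :
    Measurable (seqShift : (ℕ → β) → ℕ → β) :=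
  measurable_pi_lambda _ fun k => measurable_pi_apply (k + 1)

/-- An invariant set cannot distinguish sequences whose tails agree after shifting, possibly by
different amounts. -/
lemma mem_of_seqShift_iterate_eq {β : Type*} {A : Set (ℕ → β)} (hA : seqShift ⁻¹' A = A)
    {x y : ℕ → β} {m n : ℕ} (h : seqShift^[m] x = seqShift^[n] y) : x ∈ A ↔ y ∈ A := by
  have key : ∀ (z : ℕ → β) k, seqShift^[k] z ∈ A ↔ z ∈ A := by
    intro z k
    induction k generalizing z with
    | zero => rfl
    | succ k ih =>
      rw [Function.iterate_succ_apply, ih]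
      exact Set.ext_iff.1 hA z
  rw [← key x m, h, key]

namespace TandemNetwork.IsStationary

variable {Ω : Type*} {net : TandemNetwork Ω} [MeasurableSpace Ω] {μ : Measure Ω}

lemma measurePreserving_seqShift (hnet : net.IsStationary μ) :
    MeasurePreserving seqShift (μ.map net.path) (μ.map net.path) := by
  refine ⟨measurable_seqShift, ?_⟩
  rw [Measure.map_map measurable_seqShift hnet.measurable_path]
  let q : (ℕ → ℝ × ℝ × ℝ × ℝ × ℝ) → ℕ → ℝ × ℝ := fun x k => ((x k).1, (x k).2.2.2.2)
  have hq : Measurable q := by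
    refine measurable_pi_lambda _ fun k => ?_
    have : Measurable fun p : ℝ × ℝ × ℝ × ℝ × ℝ => (p.1, p.2.2.2.2) := by fun_prop
    exact this.comp (measurable_pi_apply k)
  have hm : ∀ k, Measurable fun ω => (net.X k ω, net.St k ω, net.Sc k ω, net.commDelay k ω,
      net.delay k ω) := fun k => (hnet.measurable_X k).prodMk ((hnet.measurable_St k).prodMk
        ((hnet.measurable_Sc k).prodMk ((hnet.measurable_commDelay k).prodMk
          (hnet.measurable_delay k))))
  have := congrArg (Measure.map q) hnet.stationary
  rw [Measure.map_map hq (measurable_pi_lambda _ fun k => hm (k + 1)),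
    Measure.map_map hq (measurable_pi_lambda _ hm)] at this
  exact this

/-- The sequence of inter-arrival times and delays of a stable stationary network is ergodic. -/
theorem ergodic_seqShift [IsProbabilityMeasure μ] (hnet : net.IsStationary μ)
    (hSt : ∫ ω, net.St 0 ω ∂μ < ∫ ω, net.X 0 ω ∂μ)
    (hSc : ∫ ω, net.Sc 0 ω ∂μ < ∫ ω, net.X 0 ω ∂μ) :
    Ergodic seqShift (μ.map net.path) := by
  refine ⟨hnet.measurePreserving_seqShift, ⟨fun A hA hinv => ?_⟩⟩
  set s : ℕ → MeasurableSpace Ω := fun i => MeasurableSpace.comap (net.input i) inferInstance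
    with hs
  -- The event `net.path ⁻¹' A` may depend on the initial waits, whose independence from the inputs
  -- is not assumed. `B` is a genuine tail event of the inputs, and almost surely each of the events
  -- in the limsup holds exactly when the path lies in `A`.
  set B : Set Ω := limsup (fun m => net.freshPath m ⁻¹' A) atTop with hB
  have hBm : MeasurableSet[limsup s atTop] B := by
    rw [limsup_eq_iInf_iSup_of_nat, MeasurableSpace.measurableSet_iInf]
    intro n
    -- Dropping the first `n` events leaves only inputs with index at least `n`.
    rw [hB, ← limsup_nat_add _ n]
    refine @MeasurableSet.measurableSet_limsup Ω (⨆ i ≥ n, s i) _ fun m => ?_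
    have hle : (⨆ i ≥ m + n, s i) ≤ ⨆ i ≥ n, s i :=
      iSup₂_le fun i hi => le_iSup₂_of_le i (by omega) le_rfl
    exact hle _ (net.measurable_freshPath (m + n) hA)
  have h01 := measure_zero_or_one_of_measurableSet_limsup_atTop
    (fun n => (hnet.measurable_input n).comap_le) hnet.indep hBm
  have hAB : B =ᵐ[μ] net.path ⁻¹' A := by
    filter_upwards [hnet.ae_eventually_freshPath_eq hSt hSc] with ω hω
    have hiff : ∀ m, net.freshPath m ω ∈ A ↔ net.path ω ∈ A := by
      intro m
      obtain ⟨N, hN⟩ := hω m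
      refine mem_of_seqShift_iterate_eq hinv (m := N) (n := m + 1 + N) (funext fun j => ?_)
      rw [seqShift_iterate, seqShift_iterate, hN (j + N) (by omega)]
      congr 1
      omega
    rw [eq_iff_iff]
    change ω ∈ B ↔ net.path ω ∈ A
    rw [hB, mem_limsup_iff_frequently_mem]
    simp only [Set.mem_preimage, hiff]
    exact frequently_const
  rw [measure_congr hAB, ← Measure.map_apply hnet.measurable_path hA] at h01
  have := Measure.isProbabilityMeasure_map (μ := μ) hnet.measurable_path.aemeasurable
  rw [eventuallyConst_set']
  rcases h01 with h | h
  · exact Or.inl (ae_eq_empty.2 h)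
  · exact Or.inr (ae_eq_univ.2 ((prob_compl_eq_zero_iff hA).2 h))

end TandemNetwork.IsStationary

/-! ### From a subsequence of times to all times. -/

section Subsequence

/-- Since `b` need not be monotone, `i t` is taken one below the first index at which `b` exceeds
`t`. -/
lemma exists_tendsto_index_of_tendsto_atTop {b : ℕ → ℝ} (hb : Tendsto b atTop atTop) :
    ∃ i : ℝ → ℕ, Tendsto i atTop atTop ∧ ∀ᶠ t in atTop, b (i t) ≤ t ∧ t < b (i t + 1) := by
  have hex : ∀ t : ℝ, ∃ n, t < b n := fun t => (hb.eventually_gt_atTop t).exists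
  classical
  refine ⟨fun t => Nat.find (hex t) - 1, ?_, ?_⟩
  · rw [tendsto_atTop]
    intro K
    have : ∀ᶠ t in atTop, ∀ j ∈ Finset.range (K + 1), b j ≤ t :=
      (Finset.eventually_all _).2 fun j _ => eventually_ge_atTop (b j)
    filter_upwards [this] with t ht
    have h1 : K + 1 ≤ Nat.find (hex t) := by
      rw [Nat.le_find_iff]
      intro m hm
      exact not_lt.2 (ht m (Finset.mem_range.2 hm))
    omega
  · filter_upwards [eventually_ge_atTop (b 0)] with t ht
    have h1 : 0 < Nat.find (hex t) := by
      rw [Nat.find_pos]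
      exact not_lt.2 ht
    constructor
    · exact not_lt.1 (Nat.find_min (hex t) (m := Nat.find (hex t) - 1) (by omega))
    · rw [Nat.sub_add_cancel h1]
      exact Nat.find_spec (hex t)

variable {A : ℝ → ℝ} {b : ℕ → ℝ}

/-- If a nonnegative monotone function grows linearly along a sequence whose consecutive terms are
asymptotically equal, then it grows linearly. -/
lemma tendsto_div_of_monotoneOn_of_tendsto_subseq (hA : MonotoneOn A (Set.Ici 0))
    (hA0 : ∀ t, 0 ≤ t → 0 ≤ A t) (hb : Tendsto b atTop atTop)
    (hr : Tendsto (fun n => b (n + 1) / b n) atTop (𝓝 1)) {L : ℝ}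
    (hL : Tendsto (fun n => A (b n) / b n) atTop (𝓝 L)) :
    Tendsto (fun t => A t / t) atTop (𝓝 L) := by
  obtain ⟨i, hi, hit⟩ := exists_tendsto_index_of_tendsto_atTop hb
  -- For `b n ≤ t < b (n + 1)`, monotonicity puts `A t / t` between `A (b n) / b (n + 1)` and `A (b
  -- (n + 1)) / b n`.
  have hlow : Tendsto (fun n => A (b n) / b n * (b (n + 1) / b n)⁻¹) atTop (𝓝 L) := by
    simpa using hL.mul (hr.inv₀ one_ne_zero)
  have hupp : Tendsto (fun n => A (b (n + 1)) / b (n + 1) * (b (n + 1) / b n)) atTop (𝓝 L) := by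
    simpa using (hL.comp (tendsto_add_atTop_nat 1)).mul hr
  refine tendsto_of_tendsto_of_tendsto_of_le_of_le' (hlow.comp hi) (hupp.comp hi) ?_ ?_
  · filter_upwards [hit, hi.eventually (hb.eventually_gt_atTop 0)] with t ⟨h1, h2⟩ h3
    have ht : 0 < t := h3.trans_le h1
    have h4 : 0 < b (i t + 1) := ht.trans h2
    have e : A (b (i t)) / b (i t) * (b (i t + 1) / b (i t))⁻¹ = A (b (i t)) / b (i t + 1) := by
      field_simp
    simp only [Function.comp, e]
    exact div_le_div₀ (hA0 t ht.le) (hA h3.le ht.le h1) ht h2.le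
  · filter_upwards [hit, hi.eventually (hb.eventually_gt_atTop 0)] with t ⟨h1, h2⟩ h3
    have ht : 0 < t := h3.trans_le h1
    have h4 : 0 < b (i t + 1) := ht.trans h2
    have e : A (b (i t + 1)) / b (i t + 1) * (b (i t + 1) / b (i t)) = A (b (i t + 1)) / b (i t) := by
      field_simp
    simp only [Function.comp, e]
    exact div_le_div₀ (hA0 _ h4.le) (hA ht.le h4.le h2.le) h3 h1

lemma tendsto_div_atTop_of_monotoneOn_of_tendsto_subseq (hA : MonotoneOn A (Set.Ici 0))
    (hA0 : ∀ t, 0 ≤ t → 0 ≤ A t) (hb : Tendsto b atTop atTop)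
    (hr : Tendsto (fun n => b (n + 1) / b n) atTop (𝓝 1))
    (hL : Tendsto (fun n => A (b n) / b n) atTop atTop) :
    Tendsto (fun t => A t / t) atTop atTop := by
  obtain ⟨i, hi, hit⟩ := exists_tendsto_index_of_tendsto_atTop hb
  have hlow : Tendsto (fun n => A (b n) / b n * (b (n + 1) / b n)⁻¹) atTop atTop :=
    hL.atTop_mul_pos (by norm_num : (0 : ℝ) < 1⁻¹) (hr.inv₀ one_ne_zero)
  refine tendsto_atTop_mono' _ ?_ (hlow.comp hi)
  filter_upwards [hit, hi.eventually (hb.eventually_gt_atTop 0)] with t ⟨h1, h2⟩ h3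
  have ht : 0 < t := h3.trans_le h1
  have h4 : 0 < b (i t + 1) := ht.trans h2
  have e : A (b (i t)) / b (i t) * (b (i t + 1) / b (i t))⁻¹ = A (b (i t)) / b (i t + 1) := by
    field_simp
  simp only [Function.comp, e]
  exact div_le_div₀ (hA0 t ht.le) (hA h3.le ht.le h1) ht h2.le

end Subsequence

/-! ### Enumerating a set of indices of positive density. -/

section Nth

variable {p : ℕ → Prop}

lemma sum_range_nth_ite [DecidablePred p] (hp : {k | p k}.Infinite) (f : ℕ → ℝ) (n : ℕ) :
    ∑ k ∈ Finset.range (Nat.nth p n), (if p k then f k else 0) =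
      ∑ i ∈ Finset.range n, f (Nat.nth p i) := by
  induction n with
  | zero =>
    rw [Finset.range_zero, Finset.sum_empty]
    refine Finset.sum_eq_zero fun k hk => if_neg fun hk' => ?_
    have := Nat.nth_count hk'
    have h2 := Nat.nth_monotone hp (Nat.zero_le (Nat.count p k))
    rw [this] at h2
    exact absurd (Finset.mem_range.1 hk) (not_lt.2 h2)
  | succ n ih =>
    rw [← Finset.sum_filter] at ih ⊢
    rw [Nat.filter_range_nth_eq_insert_of_infinite hp, Finset.sum_insert (by simp), ih,
      Finset.sum_range_succ, add_comm]

/-- The gap between consecutive elements of a set of positive density is sublinear. -/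
lemma tendsto_nth_succ_div_nth {d : ℝ} (hd : 0 < d)
    (h : Tendsto (fun n : ℕ => (n : ℝ) / Nat.nth p n) atTop (𝓝 d)) :
    Tendsto (fun n : ℕ => (Nat.nth p (n + 1) : ℝ) / Nat.nth p n) atTop (𝓝 1) := by
  -- With `v n` the `n`-th element, `v (n + 1) / v n` is the product of `v (n + 1) / (n + 1)`, `(n +
  -- 1) / n` and `n / v n`.
  have h1 := (h.comp (tendsto_add_atTop_nat 1)).inv₀ hd.ne'
  have h2 : Tendsto (fun n : ℕ => ((n + 1 : ℕ) : ℝ) / n) atTop (𝓝 1) := by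
    have h3 : Tendsto (fun n : ℕ => 1 + 1 / (n : ℝ)) atTop (𝓝 (1 + 0)) :=
      tendsto_const_nhds.add tendsto_one_div_atTop_nhds_zero_nat
    rw [add_zero] at h3
    refine h3.congr' ?_
    filter_upwards [eventually_gt_atTop 0] with n hn
    field_simp
    push_cast
    ring
  have h4 := (h1.mul h2).mul h
  rw [mul_one, inv_mul_cancel₀ hd.ne'] at h4
  refine h4.congr' ?_
  filter_upwards [eventually_gt_atTop 0] with n hn
  simp only [Function.comp]
  field_simp

end Nth

/-! ### Cycles between valid tasks and the area under the age. -/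

namespace TandemNetwork

/-- The number of steps to the next valid task, as a function of the inter-arrival times and
delays. -/
noncomputable def seqNextValid (w : ℝ) (x : ℕ → ℝ × ℝ) : ℕ := sInf {n : ℕ | 1 ≤ n ∧ (x n).2 ≤ w}

/-- The time to the arrival of the next valid task. -/
noncomputable def seqCycle (w : ℝ) (x : ℕ → ℝ × ℝ) : ℝ :=
  ∑ j ∈ Finset.Icc 1 (seqNextValid w x), (x j).1

/-- The delay of the next valid task. -/
noncomputable def seqNextDelay (w : ℝ) (x : ℕ → ℝ × ℝ) : ℝ := (x (seqNextValid w x)).2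

/-- The contribution to the integral of the age of a cycle between valid tasks. -/
noncomputable def seqReward (w : ℝ) (x : ℕ → ℝ × ℝ) : ℝ :=
  seqNextDelay w x * seqCycle w x + 1 / 2 * seqCycle w x ^ 2

variable {Ω : Type*} {net : TandemNetwork Ω} {w : ℝ} {ω : Ω}

lemma seqCycle_path : seqCycle w (net.path ω) = net.cycle w ω := rfl

lemma seqNextDelay_path : seqNextDelay w (net.path ω) = net.nextDelay w ω := rfl

lemma measurable_seqNextValid : Measurable (seqNextValid w) := by
  have hV : ∀ n, MeasurableSet {x : ℕ → ℝ × ℝ | (x n).2 ≤ w} := fun n =>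
    measurableSet_le (measurable_pi_apply n).snd measurable_const
  refine measurable_of_Iic fun n => ?_
  -- The second set collects the sequences without a later valid task, for which `sInf ∅ = 0`.
  have e : seqNextValid w ⁻¹' Set.Iic n =
      (⋃ m ∈ Set.Icc 1 n, {x : ℕ → ℝ × ℝ | (x m).2 ≤ w}) ∪
        ⋂ m ∈ Set.Ici 1, {x : ℕ → ℝ × ℝ | (x m).2 ≤ w}ᶜ := by
    ext x
    simp only [Set.mem_preimage, Set.mem_Iic, Set.mem_union, Set.mem_iUnion, Set.mem_iInter,
      Set.mem_Icc, Set.mem_Ici, Set.mem_compl_iff, exists_prop]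
    constructor
    · intro hx
      by_cases hne : {n : ℕ | 1 ≤ n ∧ (x n).2 ≤ w}.Nonempty
      · have := Nat.sInf_mem hne
        exact Or.inl ⟨_, ⟨this.1, hx⟩, this.2⟩
      · exact Or.inr fun m hm hm' => hne ⟨m, hm, hm'⟩
    · rintro (⟨m, ⟨h1, h2⟩, h3⟩ | h)
      · exact (Nat.sInf_le (show m ∈ {n : ℕ | 1 ≤ n ∧ (x n).2 ≤ w} from ⟨h1, h3⟩)).trans h2
      · have : {n : ℕ | 1 ≤ n ∧ (x n).2 ≤ w} = ∅ :=
          Set.eq_empty_iff_forall_notMem.2 fun m hm => h m hm.1 hm.2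
        simp [seqNextValid, this]
  rw [e]
  exact (MeasurableSet.biUnion (Set.to_countable _) fun m _ => hV m).union
    (MeasurableSet.biInter (Set.to_countable _) fun m _ => (hV m).compl)

lemma measurable_seqCycle : Measurable (seqCycle w) := by
  have h : Measurable fun p : (ℕ → ℝ × ℝ) × ℕ => ∑ j ∈ Finset.Icc 1 p.2, (p.1 j).1 :=
    measurable_from_prod_countable_left fun n =>
      Finset.measurable_fun_sum (Finset.Icc 1 n) fun j _ => (measurable_pi_apply j).fst
  exact h.comp (measurable_id.prodMk measurable_seqNextValid)

lemma measurable_seqNextDelay : Measurable (seqNextDelay w) := by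
  have h : Measurable fun p : (ℕ → ℝ × ℝ) × ℕ => (p.1 p.2).2 :=
    measurable_from_prod_countable_left fun n => (measurable_pi_apply n).snd
  exact h.comp (measurable_id.prodMk measurable_seqNextValid)

lemma measurable_seqReward : Measurable (seqReward w) :=
  (measurable_seqNextDelay.mul measurable_seqCycle).add
    ((measurable_seqCycle.pow_const 2).const_mul _)

/-- The sequences that start with a valid task. -/
def validSeq (w : ℝ) : Set (ℕ → ℝ × ℝ) := {x | (x 0).2 ≤ w}

lemma measurableSet_validSeq : MeasurableSet (validSeq w) :=
  measurableSet_le (measurable_pi_apply 0).snd measurable_const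

lemma seqShift_iterate_path_mem_validSeq {k : ℕ} :
    seqShift^[k] (net.path ω) ∈ validSeq w ↔ net.Valid w k ω := by
  simp [validSeq, seqShift_iterate, path, Valid]

/-- The `i`-th valid task. -/
noncomputable def validIdx (net : TandemNetwork Ω) (w : ℝ) (ω : Ω) (i : ℕ) : ℕ :=
  Nat.nth (fun k => net.Valid w k ω) i

section Infinite

variable (hinf : {k | net.Valid w k ω}.Infinite)
include hinf

lemma valid_validIdx (i : ℕ) : net.Valid w (net.validIdx w ω i) ω := Nat.nth_mem_of_infinite hinf i

lemma strictMono_validIdx : StrictMono (net.validIdx w ω) := Nat.nth_strictMono hinf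

/-- This turns averages over tasks into sums over cycles, so the ergodic theorem is needed only for
the shift and not for the map induced on `validSeq`. -/
lemma birkhoffSum_indicator_validSeq (φ : (ℕ → ℝ × ℝ) → ℝ) (n : ℕ) :
    birkhoffSum seqShift ((validSeq w).indicator φ) (net.validIdx w ω n) (net.path ω) =
      ∑ i ∈ Finset.range n, φ (seqShift^[net.validIdx w ω i] (net.path ω)) := by
  classical
  simp only [validIdx]
  rw [← sum_range_nth_ite hinf (fun k => φ (seqShift^[k] (net.path ω))), birkhoffSum]
  refine Finset.sum_congr rfl fun k _ => ?_
  simp only [Set.indicator, seqShift_iterate_path_mem_validSeq]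

lemma seqNextValid_validIdx (i : ℕ) :
    seqNextValid w (seqShift^[net.validIdx w ω i] (net.path ω)) + net.validIdx w ω i =
      net.validIdx w ω (i + 1) := by
  have hlt : net.validIdx w ω i < net.validIdx w ω (i + 1) := strictMono_validIdx hinf i.lt_succ_self
  have hmem : net.validIdx w ω (i + 1) - net.validIdx w ω i ∈
      {n : ℕ | 1 ≤ n ∧ (seqShift^[net.validIdx w ω i] (net.path ω) n).2 ≤ w} := by
    refine ⟨by omega, ?_⟩
    rw [seqShift_iterate, Nat.sub_add_cancel hlt.le]
    exact valid_validIdx hinf (i + 1)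
  have h1 := Nat.sInf_le hmem
  have h2 := Nat.sInf_mem ⟨_, hmem⟩
  change seqNextValid w _ ≤ _ at h1
  change 1 ≤ seqNextValid w _ ∧ _ at h2
  set m := seqNextValid w (seqShift^[net.validIdx w ω i] (net.path ω))
  refine le_antisymm (by omega) ?_
  by_contra! hc
  have hv : net.Valid w (m + net.validIdx w ω i) ω := by
    have := h2.2
    rw [seqShift_iterate] at this
    exact this
  have := Nat.le_nth_of_lt_nth_succ hc hv
  change _ ≤ net.validIdx w ω i at this
  omega

lemma seqNextDelay_validIdx (i : ℕ) :
    seqNextDelay w (seqShift^[net.validIdx w ω i] (net.path ω)) =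
      net.delay (net.validIdx w ω (i + 1)) ω := by
  rw [seqNextDelay, seqShift_iterate, seqNextValid_validIdx hinf]
  rfl

omit hinf in
lemma sum_Icc_seqShift_iterate_path (k m : ℕ) :
    ∑ j ∈ Finset.Icc 1 m, (seqShift^[k] (net.path ω) j).1 =
      net.arrival (m + k) ω - net.arrival k ω := by
  induction m with
  | zero => simp
  | succ m ih =>
    rw [Finset.sum_Icc_succ_top (by omega), ih, seqShift_iterate, add_right_comm m 1 k,
      arrival_succ, path]
    ring

lemma seqCycle_validIdx (i : ℕ) :
    seqCycle w (seqShift^[net.validIdx w ω i] (net.path ω)) =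
      net.arrival (net.validIdx w ω (i + 1)) ω - net.arrival (net.validIdx w ω i) ω := by
  rw [seqCycle, sum_Icc_seqShift_iterate_path, seqNextValid_validIdx hinf]

/-- The cycles between valid tasks add up to the arrival times. -/
lemma birkhoffSum_seqCycle (n : ℕ) :
    birkhoffSum seqShift ((validSeq w).indicator (seqCycle w)) (net.validIdx w ω n) (net.path ω) =
      net.arrival (net.validIdx w ω n) ω - net.arrival (net.validIdx w ω 0) ω := by
  rw [birkhoffSum_indicator_validSeq hinf]
  simp_rw [seqCycle_validIdx hinf]
  exact Finset.sum_range_sub (fun i => net.arrival (net.validIdx w ω i) ω) n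

end Infinite

section Age

variable [MeasurableSpace Ω] {μ : Measure Ω} (hnet : net.IsStationary μ)
include hnet

lemma IsStationary.arrival_mono (ω : Ω) : Monotone fun k => net.arrival k ω :=
  monotone_nat_of_le_succ fun k => by
    rw [arrival_succ]
    linarith [hnet.X_nonneg (k + 1) ω]

lemma IsStationary.finish_mono (ω : Ω) : Monotone fun k => net.finish k ω :=
  monotone_nat_of_le_succ fun k => by
    have : net.start k ω + net.Sc k ω ≤ net.start (k + 1) ω := le_max_right _ _
    simp only [finish] at this ⊢
    linarith [hnet.Sc_nonneg (k + 1) ω]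

omit [MeasurableSpace Ω] hnet in
lemma finish_eq (k : ℕ) (ω : Ω) : net.finish k ω = net.arrival k ω + net.delay k ω := by
  rw [delay]
  ring

lemma IsStationary.arrival_le_finish (k : ℕ) (ω : Ω) : net.arrival k ω ≤ net.finish k ω := by
  rw [finish_eq]
  linarith [hnet.delay_nonneg k ω]

variable (ha : Tendsto (fun k => net.arrival k ω) atTop atTop)
include ha

/-- Boundedness matters because `sSup` of an unbounded set of naturals is `0`. -/
lemma IsStationary.bddAbove_completed (t : ℝ) :
    BddAbove {k : ℕ | net.finish k ω ≤ t ∧ net.Valid w k ω} := by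
  obtain ⟨K, hK⟩ := (ha.eventually_gt_atTop t).exists
  refine ⟨K, fun k hk => ?_⟩
  by_contra! hlt
  have h1 := hnet.arrival_mono ω hlt.le
  have h2 := hnet.arrival_le_finish k ω
  have h3 := hk.1
  simp only at h1
  linarith

lemma IsStationary.informative_mono : Monotone fun t => net.informative w t ω := by
  intro s t hst
  simp only [informative]
  by_cases hne : {k : ℕ | net.finish k ω ≤ s ∧ net.Valid w k ω}.Nonempty
  · exact csSup_le_csSup (hnet.bddAbove_completed ha t) hne fun k hk => ⟨hk.1.trans hst, hk.2⟩
  · rw [Set.not_nonempty_iff_eq_empty.1 hne]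
    simp

lemma IsStationary.aocHard_nonneg {t : ℝ} (ht : 0 ≤ t) : 0 ≤ net.aocHard w t ω := by
  rw [aocHard, sub_nonneg]
  by_cases hne : {k : ℕ | net.finish k ω ≤ t ∧ net.Valid w k ω}.Nonempty
  · exact (hnet.arrival_le_finish _ ω).trans (Nat.sSup_mem hne (hnet.bddAbove_completed ha t)).1
  · rw [informative, Set.not_nonempty_iff_eq_empty.1 hne]
    simpa using ht

/-- The age is the identity minus a monotone function of time. -/
lemma IsStationary.intervalIntegrable_aocHard (s t : ℝ) :
    IntervalIntegrable (fun r => net.aocHard w r ω) volume s t := by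
  have h : Monotone fun r => net.arrival (net.informative w r ω) ω :=
    (hnet.arrival_mono ω).comp (hnet.informative_mono ha)
  exact (continuous_id.intervalIntegrable s t).sub h.intervalIntegrable

lemma IsStationary.integral_aocHard_nonneg {s t : ℝ} (hs : 0 ≤ s) (hst : s ≤ t) :
    0 ≤ ∫ r in s..t, net.aocHard w r ω :=
  intervalIntegral.integral_nonneg hst fun _ hr => hnet.aocHard_nonneg ha (hs.trans hr.1)

lemma IsStationary.monotoneOn_integral_aocHard :
    MonotoneOn (fun t => ∫ r in (0 : ℝ)..t, net.aocHard w r ω) (Set.Ici 0) := by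
  intro s hs t _ hst
  have h := intervalIntegral.integral_add_adjacent_intervals
    (hnet.intervalIntegrable_aocHard (w := w) ha 0 s) (hnet.intervalIntegrable_aocHard ha s t)
  have h2 := hnet.integral_aocHard_nonneg (w := w) ha hs hst
  simp only
  linarith

variable (hinf : {k | net.Valid w k ω}.Infinite)
include hinf

lemma IsStationary.informative_eq_validIdx {i : ℕ} {t : ℝ}
    (h1 : net.finish (net.validIdx w ω i) ω ≤ t) (h2 : t < net.finish (net.validIdx w ω (i + 1)) ω) :
    net.informative w t ω = net.validIdx w ω i := by
  have hmem : net.validIdx w ω i ∈ {k : ℕ | net.finish k ω ≤ t ∧ net.Valid w k ω} :=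
    ⟨h1, valid_validIdx hinf i⟩
  refine le_antisymm (csSup_le ⟨_, hmem⟩ fun k hk => ?_)
    (le_csSup (hnet.bddAbove_completed ha t) hmem)
  refine Nat.le_nth_of_lt_nth_succ ?_ hk.2
  by_contra! hle
  exact absurd (hnet.finish_mono ω hle) (not_le.2 (hk.1.trans_lt h2))

/-- With delays `T`, `T'` at the two ends and cycle length `C`, the age rises linearly from `T` to
`T' + C`, and `((T' + C)² - T²) / 2 = T' C + C² / 2 + (T'² - T²) / 2`. -/
lemma IsStationary.integral_aocHard_cycle (i : ℕ) :
    ∫ r in net.finish (net.validIdx w ω i) ω..net.finish (net.validIdx w ω (i + 1)) ω,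
        net.aocHard w r ω =
      seqReward w (seqShift^[net.validIdx w ω i] (net.path ω)) +
        (net.delay (net.validIdx w ω (i + 1)) ω ^ 2 - net.delay (net.validIdx w ω i) ω ^ 2) / 2 := by
  have hle : net.finish (net.validIdx w ω i) ω ≤ net.finish (net.validIdx w ω (i + 1)) ω :=
    hnet.finish_mono ω (strictMono_validIdx hinf i.lt_succ_self).le
  have e : ∫ r in net.finish (net.validIdx w ω i) ω..net.finish (net.validIdx w ω (i + 1)) ω,
        net.aocHard w r ω =
      ∫ r in net.finish (net.validIdx w ω i) ω..net.finish (net.validIdx w ω (i + 1)) ω,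
        (r - net.arrival (net.validIdx w ω i) ω) := by
    refine intervalIntegral.integral_congr_ae ?_
    -- The right endpoint is discarded because the informative task changes there.
    filter_upwards [Measure.ae_ne volume (net.finish (net.validIdx w ω (i + 1)) ω)] with r hr hr'
    rw [Set.uIoc_of_le hle] at hr'
    rw [aocHard, hnet.informative_eq_validIdx ha hinf hr'.1.le (lt_of_le_of_ne hr'.2 hr)]
  rw [e, intervalIntegral.integral_sub (by simp) (by simp), integral_id,
    intervalIntegral.integral_const, seqReward, seqCycle_validIdx hinf, seqNextDelay_validIdx hinf,
    finish_eq, finish_eq, smul_eq_mul]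
  ring

lemma IsStationary.integral_aocHard_finish (n : ℕ) :
    ∫ r in (0 : ℝ)..net.finish (net.validIdx w ω n) ω, net.aocHard w r ω =
      birkhoffSum seqShift ((validSeq w).indicator (seqReward w)) (net.validIdx w ω n)
        (net.path ω) + net.delay (net.validIdx w ω n) ω ^ 2 / 2 +
      ((∫ r in (0 : ℝ)..net.finish (net.validIdx w ω 0) ω, net.aocHard w r ω) -
        net.delay (net.validIdx w ω 0) ω ^ 2 / 2) := by
  rw [birkhoffSum_indicator_validSeq hinf]
  induction n with
  | zero =>
    rw [Finset.range_zero, Finset.sum_empty]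
    ring
  | succ n ih =>
    rw [← intervalIntegral.integral_add_adjacent_intervals
      (hnet.intervalIntegrable_aocHard ha 0 (net.finish (net.validIdx w ω n) ω))
      (hnet.intervalIntegrable_aocHard ha _ _), ih, hnet.integral_aocHard_cycle ha hinf,
      Finset.sum_range_succ]
    ring

end Age

end TandemNetwork

/-! ### Limits along the valid tasks of a fixed sample path. -/

namespace TandemNetwork

variable {Ω : Type*} {net : TandemNetwork Ω} {w : ℝ} {ω : Ω}

/-- Finitely many valid tasks would have density zero. -/
lemma infinite_valid {d : ℝ} (hd : 0 < d)
    (h : Tendsto (fun n : ℕ => birkhoffSum seqShift ((validSeq w).indicator fun _ => (1 : ℝ)) n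
      (net.path ω) / n) atTop (𝓝 d)) : {k | net.Valid w k ω}.Infinite := by
  classical
  intro hfin
  obtain ⟨K, hK⟩ := hfin.bddAbove
  have hle : ∀ n, birkhoffSum seqShift ((validSeq w).indicator fun _ => (1 : ℝ)) n
      (net.path ω) ≤ (K + 1 : ℕ) := by
    intro n
    simp only [birkhoffSum, Set.indicator, seqShift_iterate_path_mem_validSeq]
    rw [← Finset.sum_filter, Finset.sum_const, nsmul_eq_mul, mul_one, ← Finset.card_range (K + 1)]
    gcongr
    intro k hk
    exact Finset.mem_range.2 (Nat.lt_succ_of_le (hK (Finset.mem_filter.1 hk).2))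
  have h2 := le_of_tendsto_of_tendsto' h (tendsto_const_div_atTop_nhds_zero_nat ((K + 1 : ℕ) : ℝ))
    fun n => div_le_div_of_nonneg_right (hle n) (by positivity)
  linarith

lemma arrival_eq_birkhoffSum (n : ℕ) :
    birkhoffSum seqShift (fun x : ℕ → ℝ × ℝ => (x 1).1) n (net.path ω) = net.arrival n ω := by
  induction n with
  | zero => simp
  | succ n ih =>
    rw [birkhoffSum_succ, ih, arrival_succ, seqShift_iterate, add_comm 1 n]
    rfl

section Limits

variable (hinf : {k | net.Valid w k ω}.Infinite)
include hinf

lemma tendsto_validIdx : Tendsto (net.validIdx w ω) atTop atTop :=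
  (strictMono_validIdx hinf).tendsto_atTop

lemma tendsto_div_validIdx {d : ℝ}
    (h : Tendsto (fun n : ℕ => birkhoffSum seqShift ((validSeq w).indicator fun _ => (1 : ℝ)) n
      (net.path ω) / n) atTop (𝓝 d)) :
    Tendsto (fun n : ℕ => (n : ℝ) / net.validIdx w ω n) atTop (𝓝 d) := by
  refine (h.comp (tendsto_validIdx hinf)).congr fun n => ?_
  simp only [Function.comp]
  rw [birkhoffSum_indicator_validSeq hinf]
  simp

omit hinf in
lemma tendsto_const_div_natCast_comp {v : ℕ → ℕ} (hv : Tendsto v atTop atTop) (c : ℝ) :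
    Tendsto (fun n => c / (v n : ℝ)) atTop (𝓝 0) :=
  (tendsto_const_div_atTop_nhds_zero_nat c).comp hv

/-- The cycles telescope to an arrival time, so no integrability of the cycle is needed; Kac's
formula rests on this. -/
lemma tendsto_birkhoffSum_seqCycle {e : ℝ}
    (ha : Tendsto (fun n : ℕ => net.arrival n ω / n) atTop (𝓝 e)) :
    Tendsto (fun n : ℕ => birkhoffSum seqShift ((validSeq w).indicator (seqCycle w))
      (net.validIdx w ω n) (net.path ω) / net.validIdx w ω n) atTop (𝓝 e) := by
  have h := (ha.comp (tendsto_validIdx hinf)).sub (tendsto_const_div_natCast_comp (tendsto_validIdx hinf)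
    (net.arrival (net.validIdx w ω 0) ω))
  rw [sub_zero] at h
  refine h.congr fun n => ?_
  rw [birkhoffSum_seqCycle hinf, sub_div]
  rfl

variable [MeasurableSpace Ω] {μ : Measure Ω} (hnet : net.IsStationary μ)
include hnet

lemma IsStationary.tendsto_delay_validIdx_div (q : ℕ) :
    Tendsto (fun n : ℕ => net.delay (net.validIdx w ω n) ω ^ q / net.validIdx w ω n) atTop
      (𝓝 0) := by
  refine squeeze_zero (fun n => ?_) (fun n => ?_)
    (tendsto_const_div_natCast_comp (tendsto_validIdx hinf) (w ^ q))
  · have := hnet.delay_nonneg (net.validIdx w ω n) ω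
    positivity
  · have := hnet.delay_nonneg (net.validIdx w ω n) ω
    have h2 : net.delay (net.validIdx w ω n) ω ≤ w := valid_validIdx hinf n
    gcongr

variable {e d : ℝ} (he : 0 < e) (ha : Tendsto (fun n : ℕ => net.arrival n ω / n) atTop (𝓝 e))
include ha

lemma IsStationary.tendsto_finish_div_validIdx :
    Tendsto (fun n : ℕ => net.finish (net.validIdx w ω n) ω / net.validIdx w ω n) atTop
      (𝓝 e) := by
  have h := (ha.comp (tendsto_validIdx hinf)).add (hnet.tendsto_delay_validIdx_div hinf 1)
  rw [add_zero] at h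
  refine h.congr fun n => ?_
  rw [finish_eq, add_div, pow_one]
  rfl

include he

omit hinf hnet [MeasurableSpace Ω] in
lemma tendsto_arrival_atTop : Tendsto (fun n => net.arrival n ω) atTop atTop := by
  refine (ha.pos_mul_atTop he tendsto_natCast_atTop_atTop).congr' ?_
  filter_upwards [eventually_gt_atTop 0] with n hn
  field_simp

lemma IsStationary.tendsto_finish_validIdx_atTop :
    Tendsto (fun n => net.finish (net.validIdx w ω n) ω) atTop atTop :=
  tendsto_atTop_mono (fun _ => hnet.arrival_le_finish _ ω)
    ((tendsto_arrival_atTop he ha).comp (tendsto_validIdx hinf))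

omit he ha hnet [MeasurableSpace Ω] in
lemma eventually_validIdx_pos : ∀ᶠ n in atTop, 0 < net.validIdx w ω n :=
  (tendsto_validIdx hinf).eventually_gt_atTop 0

variable (hd : 0 < d) (hdens : Tendsto (fun n : ℕ => birkhoffSum seqShift
  ((validSeq w).indicator fun _ => (1 : ℝ)) n (net.path ω) / n) atTop (𝓝 d))
include hd hdens

/-- Completion times are asymptotically `e` times the index, and indices of valid tasks have
sublinear gaps because their density `d` is positive. -/
lemma IsStationary.tendsto_finish_validIdx_succ_div :
    Tendsto (fun n => net.finish (net.validIdx w ω (n + 1)) ω / net.finish (net.validIdx w ω n) ω)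
      atTop (𝓝 1) := by
  have h1 := hnet.tendsto_finish_div_validIdx hinf ha
  have h2 := tendsto_nth_succ_div_nth hd (tendsto_div_validIdx hinf hdens)
  have h3 := ((h1.comp (tendsto_add_atTop_nat 1)).mul h2).mul (h1.inv₀ he.ne')
  rw [mul_one, mul_inv_cancel₀ he.ne'] at h3
  refine h3.congr' ?_
  filter_upwards [eventually_validIdx_pos hinf,
    (tendsto_add_atTop_nat 1).eventually (eventually_validIdx_pos hinf),
    (hnet.tendsto_finish_validIdx_atTop hinf he ha).eventually_gt_atTop 0] with n hn hn1 hn2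
  simp only [Function.comp]
  change _ * ((net.validIdx w ω (n + 1) : ℝ) / (net.validIdx w ω n : ℝ)) * _ = _
  have : (0 : ℝ) < net.validIdx w ω n := by exact_mod_cast hn
  have : (0 : ℝ) < net.validIdx w ω (n + 1) := by exact_mod_cast hn1
  field_simp

/-- The time average of the age when the rewards of the cycles have a finite mean. -/
lemma IsStationary.tendsto_average_aocHard {γ : ℝ}
    (hγ : Tendsto (fun n : ℕ => birkhoffSum seqShift ((validSeq w).indicator (seqReward w)) n
      (net.path ω) / n) atTop (𝓝 γ)) :
    Tendsto (fun t : ℝ => (1 / t) * ∫ s in (0 : ℝ)..t, net.aocHard w s ω) atTop (𝓝 (γ / e)) := by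
  have hat := tendsto_arrival_atTop he ha
  have h1 := ((hγ.comp (tendsto_validIdx hinf)).add
    ((hnet.tendsto_delay_validIdx_div hinf 2).div_const 2)).add
    (tendsto_const_div_natCast_comp (tendsto_validIdx hinf)
      ((∫ r in (0 : ℝ)..net.finish (net.validIdx w ω 0) ω, net.aocHard w r ω) -
        net.delay (net.validIdx w ω 0) ω ^ 2 / 2))
  rw [zero_div, add_zero, add_zero] at h1
  -- Area per task over elapsed time per task, both at the completion of the `n`-th valid task.
  have h2 := h1.div (hnet.tendsto_finish_div_validIdx hinf ha) he.ne'
  refine (tendsto_div_of_monotoneOn_of_tendsto_subseq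
    (A := fun t => ∫ s in (0 : ℝ)..t, net.aocHard w s ω) (hnet.monotoneOn_integral_aocHard hat)
    (fun t ht => hnet.integral_aocHard_nonneg hat le_rfl ht)
    (hnet.tendsto_finish_validIdx_atTop hinf he ha)
    (hnet.tendsto_finish_validIdx_succ_div hinf he ha hd hdens) (h2.congr' ?_)).congr fun t => ?_
  · filter_upwards [eventually_validIdx_pos hinf] with n hn
    have : (0 : ℝ) < net.validIdx w ω n := by exact_mod_cast hn
    rw [hnet.integral_aocHard_finish hat hinf n]
    simp only [Function.comp, Pi.div_apply]
    rw [div_right_comm _ _ (2 : ℝ), ← add_div, ← add_div, div_div_div_cancel_right₀ this.ne']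
  · rw [one_div, div_eq_inv_mul]

/-- The time average of the age diverges when that of the rewards of the cycles does. -/
lemma IsStationary.tendsto_average_aocHard_atTop
    (hγ : Tendsto (fun n : ℕ => birkhoffSum seqShift ((validSeq w).indicator (seqReward w)) n
      (net.path ω) / n) atTop atTop) :
    Tendsto (fun t : ℝ => (1 / t) * ∫ s in (0 : ℝ)..t, net.aocHard w s ω) atTop atTop := by
  have hat := tendsto_arrival_atTop he ha
  have h1 := ((hγ.comp (tendsto_validIdx hinf)).atTop_add
    ((hnet.tendsto_delay_validIdx_div hinf 2).div_const 2)).atTop_add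
    (tendsto_const_div_natCast_comp (tendsto_validIdx hinf)
      ((∫ r in (0 : ℝ)..net.finish (net.validIdx w ω 0) ω, net.aocHard w r ω) -
        net.delay (net.validIdx w ω 0) ω ^ 2 / 2))
  have h2 := h1.atTop_mul_pos (inv_pos.2 he)
    ((hnet.tendsto_finish_div_validIdx hinf ha).inv₀ he.ne')
  refine (tendsto_div_atTop_of_monotoneOn_of_tendsto_subseq
    (A := fun t => ∫ s in (0 : ℝ)..t, net.aocHard w s ω) (hnet.monotoneOn_integral_aocHard hat)
    (fun t ht => hnet.integral_aocHard_nonneg hat le_rfl ht)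
    (hnet.tendsto_finish_validIdx_atTop hinf he ha)
    (hnet.tendsto_finish_validIdx_succ_div hinf he ha hd hdens) (h2.congr' ?_)).congr fun t => ?_
  · filter_upwards [eventually_validIdx_pos hinf] with n hn
    have : (0 : ℝ) < net.validIdx w ω n := by exact_mod_cast hn
    rw [hnet.integral_aocHard_finish hat hinf n]
    simp only [Function.comp]
    rw [div_right_comm _ _ (2 : ℝ), ← add_div, ← add_div, ← div_eq_mul_inv,
      div_div_div_cancel_right₀ this.ne']
  · rw [one_div, div_eq_inv_mul]

end Limits

end TandemNetwork

/-! ### Kac's formula and integrability of the cycle quantities. -/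

namespace TandemNetwork

variable {Ω : Type*} {net : TandemNetwork Ω} {w : ℝ}

lemma indicator_validSeq_path (φ : (ℕ → ℝ × ℝ) → ℝ) (ω : Ω) :
    (validSeq w).indicator φ (net.path ω) =
      {ω | net.Valid w 0 ω}.indicator (fun ω => φ (net.path ω)) ω := rfl

lemma exists_valid_of_infinite {ω : Ω} (hinf : {k | net.Valid w k ω}.Infinite) :
    ∃ n : ℕ, 1 ≤ n ∧ net.Valid w n ω := by
  obtain ⟨n, hn, h1⟩ := hinf.exists_gt 0
  exact ⟨n, h1, hn⟩

lemma nextDelay_le_of_infinite {ω : Ω} (hinf : {k | net.Valid w k ω}.Infinite) :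
    net.nextDelay w ω ≤ w :=
  (Nat.sInf_mem (show {n : ℕ | 1 ≤ n ∧ net.Valid w n ω}.Nonempty from
    exists_valid_of_infinite hinf)).2

variable [MeasurableSpace Ω] {μ : Measure Ω}

namespace IsStationary

lemma cycle_nonneg (hnet : net.IsStationary μ) (ω : Ω) : 0 ≤ net.cycle w ω :=
  Finset.sum_nonneg fun j _ => hnet.X_nonneg j ω

lemma nextDelay_nonneg (hnet : net.IsStationary μ) (ω : Ω) : 0 ≤ net.nextDelay w ω :=
  hnet.delay_nonneg _ ω

lemma measurableSet_valid (hnet : net.IsStationary μ) : MeasurableSet {ω | net.Valid w 0 ω} :=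
  measurableSet_le (hnet.measurable_delay 0) measurable_const

lemma measurable_cycle (hnet : net.IsStationary μ) : Measurable (net.cycle w) := by
  have h : net.cycle w = seqCycle w ∘ net.path := funext fun _ => seqCycle_path.symm
  rw [h]
  exact measurable_seqCycle.comp hnet.measurable_path

lemma measurable_nextDelay (hnet : net.IsStationary μ) : Measurable (net.nextDelay w) := by
  have h : net.nextDelay w = seqNextDelay w ∘ net.path := funext fun _ => seqNextDelay_path.symm
  rw [h]
  exact measurable_seqNextDelay.comp hnet.measurable_path

section Ergodic

variable [IsProbabilityMeasure μ]

lemma ae_tendsto_birkhoffSum_path (hnet : net.IsStationary μ)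
    (herg : Ergodic seqShift (μ.map net.path)) {φ : (ℕ → ℝ × ℝ) → ℝ} (hφ : Measurable φ)
    (hi : Integrable (fun ω => φ (net.path ω)) μ) :
    ∀ᵐ ω ∂μ, Tendsto (fun n : ℕ => birkhoffSum seqShift φ n (net.path ω) / n) atTop
      (𝓝 (∫ ω, φ (net.path ω) ∂μ)) := by
  have := Measure.isProbabilityMeasure_map (μ := μ) hnet.measurable_path.aemeasurable
  have h := herg.ae_tendsto_birkhoffSum_div hφ ((integrable_map_measure
    hφ.aestronglyMeasurable hnet.measurable_path.aemeasurable).2 hi)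
  rw [integral_map hnet.measurable_path.aemeasurable hφ.aestronglyMeasurable] at h
  exact ae_of_ae_map hnet.measurable_path.aemeasurable h

lemma ae_tendsto_birkhoffSum_path_atTop (hnet : net.IsStationary μ)
    (herg : Ergodic seqShift (μ.map net.path)) {φ : (ℕ → ℝ × ℝ) → ℝ} (hφ : Measurable φ)
    (h0 : ∀ᵐ ω ∂μ, 0 ≤ φ (net.path ω)) (hi : ¬ Integrable (fun ω => φ (net.path ω)) μ) :
    ∀ᵐ ω ∂μ, Tendsto (fun n : ℕ => birkhoffSum seqShift φ n (net.path ω) / n) atTop atTop := by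
  have := Measure.isProbabilityMeasure_map (μ := μ) hnet.measurable_path.aemeasurable
  refine ae_of_ae_map hnet.measurable_path.aemeasurable
    (herg.ae_tendsto_birkhoffSum_div_atTop hφ ?_ fun hc => hi ((integrable_map_measure
      hφ.aestronglyMeasurable hnet.measurable_path.aemeasurable).1 hc))
  exact (ae_map_iff hnet.measurable_path.aemeasurable
    (measurableSet_le measurable_const hφ)).2 h0

lemma ae_tendsto_arrival_div (hnet : net.IsStationary μ)
    (herg : Ergodic seqShift (μ.map net.path)) :
    ∀ᵐ ω ∂μ, Tendsto (fun n : ℕ => net.arrival n ω / n) atTop (𝓝 (∫ ω, net.X 0 ω ∂μ)) := by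
  have hid : IdentDistrib (net.X 1) (net.X 0) μ μ := (hnet.ident 1).comp measurable_fst
  have h := hnet.ae_tendsto_birkhoffSum_path herg (φ := fun x => (x 1).1)
    (measurable_pi_apply 1).fst (hid.integrable_iff.2 hnet.integrable_X)
  simp only [arrival_eq_birkhoffSum] at h
  rw [show ∫ ω, (net.path ω 1).1 ∂μ = ∫ ω, net.X 0 ω ∂μ from hid.integral_eq] at h
  exact h

lemma ae_tendsto_birkhoffSum_valid (hnet : net.IsStationary μ)
    (herg : Ergodic seqShift (μ.map net.path)) :
    ∀ᵐ ω ∂μ, Tendsto (fun n : ℕ => birkhoffSum seqShift ((validSeq w).indicator fun _ => (1 : ℝ)) n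
      (net.path ω) / n) atTop (𝓝 (μ.real {ω | net.Valid w 0 ω})) := by
  have h := hnet.ae_tendsto_birkhoffSum_path herg
    (measurable_const.indicator (measurableSet_validSeq (w := w)))
    (φ := (validSeq w).indicator fun _ => (1 : ℝ))
    ((integrable_const (1 : ℝ)).indicator hnet.measurableSet_valid)
  simp_rw [indicator_validSeq_path] at h
  rw [integral_indicator hnet.measurableSet_valid] at h
  simpa using h

lemma ae_infinite_valid (hnet : net.IsStationary μ) (herg : Ergodic seqShift (μ.map net.path))
    (hvalid : 0 < μ {ω | net.Valid w 0 ω}) :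
    ∀ᵐ ω ∂μ, {k | net.Valid w k ω}.Infinite := by
  filter_upwards [hnet.ae_tendsto_birkhoffSum_valid (w := w) herg] with ω h
  exact infinite_valid (ENNReal.toReal_pos hvalid.ne' (measure_ne_top _ _)) h

/-- **Kac's formula**: the mean time from a valid task to the next one. -/
lemma integrableOn_cycle_and_setIntegral_cycle (hnet : net.IsStationary μ)
    (herg : Ergodic seqShift (μ.map net.path)) (hvalid : 0 < μ {ω | net.Valid w 0 ω}) :
    IntegrableOn (net.cycle w) {ω | net.Valid w 0 ω} μ ∧
      ∫ ω in {ω | net.Valid w 0 ω}, net.cycle w ω ∂μ = ∫ ω, net.X 0 ω ∂μ := by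
  have hm : Measurable ((validSeq w).indicator (seqCycle w)) :=
    measurable_seqCycle.indicator measurableSet_validSeq
  have hlim : ∀ᵐ ω ∂μ, Tendsto (fun n : ℕ => birkhoffSum seqShift
      ((validSeq w).indicator (seqCycle w)) (net.validIdx w ω n) (net.path ω) /
        net.validIdx w ω n) atTop (𝓝 (∫ ω, net.X 0 ω ∂μ)) := by
    filter_upwards [hnet.ae_infinite_valid herg hvalid, hnet.ae_tendsto_arrival_div herg]
      with ω hinf ha
    exact tendsto_birkhoffSum_seqCycle hinf ha
  have hint : IntegrableOn (net.cycle w) {ω | net.Valid w 0 ω} μ := by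
    rw [← integrable_indicator_iff hnet.measurableSet_valid]
    -- A cycle of infinite mean would make the averages diverge, also along the valid indices, where
    -- they have a finite limit.
    by_contra hc
    have h := hnet.ae_tendsto_birkhoffSum_path_atTop herg hm (Eventually.of_forall fun ω =>
      Set.indicator_nonneg (s := {ω | net.Valid w 0 ω}) (f := net.cycle w)
        (fun ω _ => hnet.cycle_nonneg ω) ω) hc
    obtain ⟨ω, h1, h2, h3⟩ := (h.and (hlim.and (hnet.ae_infinite_valid herg hvalid))).exists
    exact not_tendsto_nhds_of_tendsto_atTop (h1.comp (tendsto_validIdx h3)) _ h2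
  refine ⟨hint, ?_⟩
  have h := hnet.ae_tendsto_birkhoffSum_path herg hm
    ((integrable_indicator_iff hnet.measurableSet_valid).2 hint)
  -- Both limits are constants, so comparing them at a single sample point suffices.
  obtain ⟨ω, h1, h2, h3⟩ := (h.and (hlim.and (hnet.ae_infinite_valid herg hvalid))).exists
  have := tendsto_nhds_unique (h1.comp (tendsto_validIdx h3)) h2
  simp_rw [indicator_validSeq_path] at this
  rw [integral_indicator hnet.measurableSet_valid] at this
  exact this

/-- The next valid delay is at most `w`, so `w` times the cycle dominates. -/
lemma integrableOn_nextDelay_mul_cycle (hnet : net.IsStationary μ)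
    (herg : Ergodic seqShift (μ.map net.path)) (hvalid : 0 < μ {ω | net.Valid w 0 ω}) :
    IntegrableOn (fun ω => net.nextDelay w ω * net.cycle w ω) {ω | net.Valid w 0 ω} μ := by
  refine ((hnet.integrableOn_cycle_and_setIntegral_cycle herg hvalid).1.const_mul w).mono'
    (hnet.measurable_nextDelay.mul hnet.measurable_cycle).aestronglyMeasurable ?_
  filter_upwards [ae_restrict_of_ae (hnet.ae_infinite_valid herg hvalid)] with ω hinf
  have h1 := hnet.cycle_nonneg (w := w) ω
  rw [Real.norm_of_nonneg (mul_nonneg (hnet.nextDelay_nonneg ω) h1)]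
  exact mul_le_mul_of_nonneg_right (nextDelay_le_of_infinite hinf) h1

end Ergodic

end IsStationary

end TandemNetwork

/-! ### The formula for the average age. -/

open TandemNetwork in
theorem theorem4 {Ω : Type*} [MeasurableSpace Ω] (μ : Measure Ω) [IsProbabilityMeasure μ]
    (net : TandemNetwork Ω) (hnet : net.IsStationary μ)
    (hSt : ∫ ω, net.St 0 ω ∂μ < ∫ ω, net.X 0 ω ∂μ)
    (hSc : ∫ ω, net.Sc 0 ω ∂μ < ∫ ω, net.X 0 ω ∂μ)
    (w : ℝ) (hw : 0 < w) (hvalid : 0 < μ {ω | net.Valid w 0 ω})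
    -- `P` is the law of the network seen from a valid task (numbered `0`)
    (P : Measure Ω) (hP : P = cond μ {ω | net.Valid w 0 ω}) :
    -- `M` is finite, and the expectations in the formula make sense
    (∀ᵐ ω ∂P, ∃ n : ℕ, 1 ≤ n ∧ net.Valid w n ω) ∧
    Integrable (fun ω => net.cycle w ω) P ∧
    0 < ∫ ω, net.cycle w ω ∂P ∧
    Integrable (fun ω => net.nextDelay w ω * net.cycle w ω) P ∧
    (∀ᵐ ω ∂μ, ∀ t : ℝ, 0 ≤ t →
      IntervalIntegrable (fun s => net.aocHard w s ω) volume 0 t) ∧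
    -- the time average of the age of computing, when the second moment is finite
    (Integrable (fun ω => net.cycle w ω ^ 2) P →
      ∀ᵐ ω ∂μ, Tendsto (fun t : ℝ => (1 / t) * ∫ s in (0 : ℝ)..t, net.aocHard w s ω) atTop
        (𝓝 ((∫ ω', net.nextDelay w ω' * net.cycle w ω' ∂P
            + (1 / 2) * ∫ ω', net.cycle w ω' ^ 2 ∂P) / ∫ ω', net.cycle w ω' ∂P))) ∧
    -- and when it is infinite
    (¬ Integrable (fun ω => net.cycle w ω ^ 2) P →
      ∀ᵐ ω ∂μ, Tendsto (fun t : ℝ => (1 / t) * ∫ s in (0 : ℝ)..t, net.aocHard w s ω)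
        atTop atTop) := by
  set V : Set Ω := {ω | net.Valid w 0 ω} with hV
  have herg := hnet.ergodic_seqShift hSt hSc
  have hX : 0 < ∫ ω, net.X 0 ω ∂μ :=
    (integral_nonneg fun ω => hnet.St_nonneg 0 ω).trans_lt hSt
  have hVm : MeasurableSet V := hnet.measurableSet_valid
  have hp : 0 < μ.real V := ENNReal.toReal_pos hvalid.ne' (measure_ne_top _ _)
  have hinf := hnet.ae_infinite_valid herg hvalid
  obtain ⟨hcyc, hkac⟩ := hnet.integrableOn_cycle_and_setIntegral_cycle herg hvalid
  have hdc := hnet.integrableOn_nextDelay_mul_cycle herg hvalid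
  -- Conditioning is restriction to `V` times a finite nonzero constant.
  have hPint : ∀ f : Ω → ℝ, Integrable f P ↔ IntegrableOn f V μ := fun f => by
    rw [hP, ProbabilityTheory.cond]
    exact integrable_smul_measure (ENNReal.inv_ne_zero.2 (measure_ne_top _ _))
      (ENNReal.inv_ne_top.2 hvalid.ne')
  have hPE : ∀ f : Ω → ℝ, ∫ ω, f ω ∂P = (μ.real V)⁻¹ * ∫ ω in V, f ω ∂μ := fun f => by
    rw [hP, ProbabilityTheory.cond, integral_smul_measure, ENNReal.toReal_inv, smul_eq_mul]
    rfl
  have harr := hnet.ae_tendsto_arrival_div herg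
  have hdens := hnet.ae_tendsto_birkhoffSum_valid (w := w) herg
  have hrm : Measurable ((validSeq w).indicator (seqReward w)) :=
    measurable_seqReward.indicator measurableSet_validSeq
  refine ⟨?_, (hPint _).2 hcyc, ?_, (hPint _).2 hdc, ?_, fun hsq => ?_, fun hsq => ?_⟩
  · rw [hP]
    exact cond_absolutelyContinuous.ae_le (hinf.mono fun ω h => exists_valid_of_infinite h)
  · rw [hPE, hkac]
    positivity
  · filter_upwards [harr] with ω ha t _
    exact hnet.intervalIntegrable_aocHard (tendsto_arrival_atTop hX ha) 0 t
  · have hsq' := ((hPint _).1 hsq).const_mul (1 / 2)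
    have hint : IntegrableOn (fun ω => seqReward w (net.path ω)) V μ := hdc.add hsq'
    have hval : ∫ ω in V, seqReward w (net.path ω) ∂μ =
        ∫ ω in V, net.nextDelay w ω * net.cycle w ω ∂μ +
          (1 / 2) * ∫ ω in V, net.cycle w ω ^ 2 ∂μ := by
      rw [← integral_const_mul, ← integral_add hdc hsq']
      rfl
    have hrew := hnet.ae_tendsto_birkhoffSum_path herg hrm ((integrable_indicator_iff hVm).2 hint)
    simp_rw [indicator_validSeq_path] at hrew
    rw [integral_indicator hVm, hval] at hrew
    filter_upwards [hinf, harr, hdens, hrew] with ω hi ha hd hr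
    have h := hnet.tendsto_average_aocHard hi hX ha hp hd hr
    -- The normalisation `(μ.real V)⁻¹` cancels between numerator and denominator.
    rw [hPE, hPE, hPE, hkac]
    convert h using 2
    field_simp
  -- The squared cycle is twice the reward minus the integrable product of delay and cycle, so an
  -- integrable reward would contradict `hsq`.
  · have hint : ¬ IntegrableOn (fun ω => seqReward w (net.path ω)) V μ := by
      intro hc
      refine hsq ((hPint _).2 ?_)
      refine IntegrableOn.congr_fun ((hc.sub hdc).const_mul 2) (fun ω _ => ?_) hVm
      simp only [Pi.sub_apply, seqReward, seqCycle_path, seqNextDelay_path]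
      ring
    have hrew := hnet.ae_tendsto_birkhoffSum_path_atTop herg hrm
      (Eventually.of_forall fun ω => Set.indicator_nonneg (s := V)
        (f := fun ω => seqReward w (net.path ω)) (fun ω _ => by
          have h1 := hnet.cycle_nonneg (w := w) ω
          have h2 := hnet.nextDelay_nonneg (w := w) ω
          simp only [seqReward, seqCycle_path, seqNextDelay_path]
          positivity) ω)
      fun hc => hint ((integrable_indicator_iff hVm).1 hc)
    filter_upwards [hinf, harr, hdens, hrew] with ω hi ha hd hr
    exact hnet.tendsto_average_aocHard_atTop hi hX ha hp hd hr
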